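/- For a real $n\times d$ matrix $M$ let $\|M\|_{\mathcal S_p}=\big(\sum_i\sigma_i(M)^p\big)^{1/p}$ be its Schatten-$p$ norm, where $\sigma_i(M)$ are its singular values. In the matrix-vector product model an algorithm accesses a matrix $A\in\mathbb R^{n\times d}$ only through adaptively chosen products $Ax$ and $A^\top y$, and its cost is the number of these products. Single-vector Krylov iteration on $AA^\top$ with starting vector $g\in\mathbb R^n$ and iteration count $t$ builds the Krylov matrix $K=[g,(AA^\top)g,\dots,(AA^\top)^tg]$, computes a matrix $Q$ whose columns are an orthonormal basis of the column span of $K$, computes a unit eigenvector $y$ of $Q^\top AA^\top Q$ for its largest eigenvalue, and outputs $v=A^\top Qy/\|A^\top Qy\|_2$ (a fixed unit vector if $A^\top Qy=0$). There is an absolute constant $C>0$ such that for all real $p\ge 1$ and $0<\varepsilon<1$ there is an iteration count $t$, depending only on $p$ and $\varepsilon$, with the following property. For all $n\ge 0$, $d\ge 1$ and every $A\in\mathbb R^{n\times d}$, single-vector Krylov iteration on $AA^\top$ with iteration count $t$ uses at most $C\,p\log(2/\varepsilon)/\varepsilon^{1/3}$ matrix-vector products and outputs a unit vector $v\in\mathbb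 R^d$, for every starting vector $g$ and every choice of $Q$ and $y$. If $g\sim\mathcal N(0,I_n)$, then, for any rule by which $Q$ and $y$ are chosen, with probability at least $0.99$ $$\|A(I-vv^\top)\|_{\mathcal S_p}\le(1+\varepsilon)\min_{\|u\|_2=1}\|A(I-uu^\top)\|_{\mathcal S_p} \quad\text{and}\quad \|A(I-vv^\top)\|_{\mathcal S_p}^p\le(1+\varepsilon)\min_{\|u\|_2=1}\|A(I-uu^\top)\|_{\mathcal S_p}^p .$$ In particular, the bound on the number of products does not depend on $n$ or $d$. -/

import Mathlib

noncomputable section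

/-- The Schatten-`p` norm of a real `n × d` matrix: the `ℓ_p` norm of its `d` singular values
(those of the linear map `M : ℝ^d → ℝ^n` between Euclidean spaces), for `0 < p < ∞`. -/
def schattenNorm {n d : ℕ} (p : ℝ) (M : Matrix (Fin n) (Fin d) ℝ) : ℝ :=
  (∑ i : Fin d, (Matrix.toEuclideanLin M).singularValues (i : ℕ) ^ p) ^ (1 / p)

/-- The Euclidean norm of a vector of reals. -/
def euclNorm {m : ℕ} (x : Fin m → ℝ) : ℝ :=
  ‖WithLp.toLp 2 x‖

/-- `A (I - u uᵀ)`. -/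
def rankOneResidual {n d : ℕ} (A : Matrix (Fin n) (Fin d) ℝ) (u : Fin d → ℝ) :
    Matrix (Fin n) (Fin d) ℝ :=
  A * (1 - Matrix.vecMulVec u u)

/-! ### The matrix-vector product model -/

/-- A deterministic adaptive algorithm in the matrix-vector product model for an unknown
`n × d` matrix `A`. It either stops with an output, or asks for a product `A x` or `Aᵀ y` and goes
on depending on the answer. The matrix enters only through the answers. Computation
between two queries is free. A randomized algorithm is a family of such programs indexed by its
random seed. -/
inductive MatVecProgram (n d : ℕ) (α : Type) : Type
  | done (a : α) : MatVecProgram n d α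
  | mul (x : Fin d → ℝ) (next : (Fin n → ℝ) → MatVecProgram n d α) : MatVecProgram n d α
  | mulTranspose (y : Fin n → ℝ) (next : (Fin d → ℝ) → MatVecProgram n d α) :
      MatVecProgram n d α

namespace MatVecProgram

/-- The output of the program when the hidden matrix is `A`. -/
def run {n d : ℕ} {α : Type} (A : Matrix (Fin n) (Fin d) ℝ) : MatVecProgram n d α → α
  | done a => a
  | mul x next => run A (next (A.mulVec x))
  | mulTranspose y next => run A (next (A.transpose.mulVec y))

/-- The number of matrix-vector products (with `A` or with `Aᵀ`) that the program uses when the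
hidden matrix is `A`. -/
def queries {n d : ℕ} {α : Type} (A : Matrix (Fin n) (Fin d) ℝ) : MatVecProgram n d α → ℕ
  | done _ => 0
  | mul x next => queries A (next (A.mulVec x)) + 1
  | mulTranspose y next => queries A (next (A.transpose.mulVec y)) + 1

/-- Sequential composition. -/
def bind {n d : ℕ} {α β : Type} :
    MatVecProgram n d α → (α → MatVecProgram n d β) → MatVecProgram n d β
  | done a, f => f a
  | mul x next, f => mul x fun z => bind (next z) f
  | mulTranspose y next, f => mulTranspose y fun z => bind (next z) f

end MatVecProgram

/-! ### Krylov iteration with a single starting vector -/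

/-- The two exact dense linear algebra subroutines that Krylov iteration calls between its
queries; neither is unique, and any correct implementation is allowed. -/
structure LinAlgSubroutines (n : ℕ) where
  /-- Returns a matrix whose columns are an orthonormal basis of the column span of `K`, together
  with its number of columns. -/
  basis : {m : ℕ} → Matrix (Fin n) (Fin m) ℝ → (r : ℕ) × Matrix (Fin n) (Fin r) ℝ
  basis_orthonormal : ∀ {m : ℕ} (K : Matrix (Fin n) (Fin m) ℝ),
    (basis K).2.transpose * (basis K).2 = 1
  basis_span : ∀ {m : ℕ} (K : Matrix (Fin n) (Fin m) ℝ),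
    Submodule.span ℝ (Set.range (basis K).2.col) = Submodule.span ℝ (Set.range K.col)
  /-- Returns a unit eigenvector of the symmetric matrix `M` for its largest eigenvalue. -/
  topEigenvector : {r : ℕ} → Matrix (Fin r) (Fin r) ℝ → (Fin r → ℝ)
  topEigenvector_spec : ∀ {r : ℕ} (M : Matrix (Fin r) (Fin r) ℝ), 0 < r → M.IsSymm →
    euclNorm (topEigenvector M) = 1 ∧
      ∃ μ : ℝ, IsGreatest (spectrum ℝ M) μ ∧
        M.mulVec (topEigenvector M) = μ • topEigenvector M

/-- Such subroutines exist. -/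
theorem LinAlgSubroutines.nonempty (n : ℕ) : Nonempty (LinAlgSubroutines n) := by
  have hb : ∀ (m : ℕ) (K : Matrix (Fin n) (Fin m) ℝ),
      ∃ Q : (r : ℕ) × Matrix (Fin n) (Fin r) ℝ, Q.2.transpose * Q.2 = 1 ∧
        Submodule.span ℝ (Set.range Q.2.col) = Submodule.span ℝ (Set.range K.col) := by
    intro m K
    let e := WithLp.linearEquiv 2 ℝ (Fin n → ℝ)
    let V : Submodule ℝ (EuclideanSpace ℝ (Fin n)) :=
      (Submodule.span ℝ (Set.range K.col)).comap e.toLinearMap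
    let b := stdOrthonormalBasis ℝ V
    refine ⟨⟨Module.finrank ℝ V, Matrix.of fun i j => (b j : EuclideanSpace ℝ (Fin n)) i⟩, ?_, ?_⟩
    · ext i j
      have h := orthonormal_iff_ite.mp b.orthonormal i j
      rw [Submodule.coe_inner, PiLp.inner_apply] at h
      simp only [Matrix.mul_apply, Matrix.transpose_apply, Matrix.of_apply, Matrix.one_apply]
      rw [← h]
      exact Finset.sum_congr rfl fun k _ => by simp [mul_comm]
    · have h1 : Submodule.span ℝ (Set.range fun j => (b j : EuclideanSpace ℝ (Fin n))) = V := by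
        have h2 := congrArg (Submodule.map V.subtype) b.toBasis.span_eq
        rw [Submodule.map_span, Submodule.map_top, Submodule.range_subtype, ← Set.range_comp] at h2
        simpa [Function.comp_def] using h2
      have h3 := congrArg (Submodule.map e.toLinearMap) h1
      rw [Submodule.map_span, ← Set.range_comp,
        Submodule.map_comap_eq_of_surjective e.surjective] at h3
      exact h3
  have ht : ∀ (r : ℕ) (M : Matrix (Fin r) (Fin r) ℝ), ∃ y : Fin r → ℝ, 0 < r → M.IsSymm →
      euclNorm y = 1 ∧ ∃ μ : ℝ, IsGreatest (spectrum ℝ M) μ ∧ M.mulVec y = μ • y := by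
    intro r M
    by_cases h : 0 < r ∧ M.IsSymm
    · obtain ⟨hr, hM⟩ := h
      have hH : M.IsHermitian := by
        rw [Matrix.IsHermitian, Matrix.conjTranspose_eq_transpose_of_trivial]
        exact hM
      have : Nonempty (Fin r) := ⟨⟨0, hr⟩⟩
      obtain ⟨i, hi⟩ := Finite.exists_max hH.eigenvalues
      refine ⟨(hH.eigenvectorBasis i).ofLp, fun _ _ => ⟨?_, hH.eigenvalues i, ⟨?_, ?_⟩, ?_⟩⟩
      · exact hH.eigenvectorBasis.orthonormal.1 i
      · exact hH.eigenvalues_mem_spectrum_real i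
      · rintro x hx
        rw [hH.spectrum_real_eq_range_eigenvalues] at hx
        obtain ⟨j, rfl⟩ := hx
        exact hi j
      · exact hH.mulVec_eigenvectorBasis i
    · exact ⟨0, fun h1 h2 => absurd ⟨h1, h2⟩ h⟩
  choose B hB1 hB2 using hb
  choose T hT using ht
  exact ⟨⟨fun K => B _ K, fun K => hB1 _ K, fun K => hB2 _ K, fun M => T _ M, fun M => hT _ M⟩⟩

/-- Queries the columns of the Krylov matrix `[g, (AAᵀ) g, …, (AAᵀ)^t g]` one after the other,
with `2 t` products. -/
def krylovColumns {n d : ℕ} (g : Fin n → ℝ) :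
    (t : ℕ) → MatVecProgram n d (Fin (t + 1) → Fin n → ℝ)
  | 0 => .done fun _ => g
  | t + 1 => (krylovColumns g t).bind fun K =>
      .mulTranspose (K (Fin.last t)) fun y =>
        .mul y fun z => .done (Fin.snoc (α := fun _ => Fin n → ℝ) K z)

/-- Queries `Aᵀ q` for each vector `q` of a list of `r` vectors, with `r` products. -/
def transposeColumns {n d : ℕ} :
    (r : ℕ) → (Fin r → Fin n → ℝ) → MatVecProgram n d (Fin r → Fin d → ℝ)
  | 0, _ => .done Fin.elim0
  | r + 1, q => .mulTranspose (q 0) fun w =>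
      (transposeColumns r fun i => q i.succ).bind fun W =>
        .done (Fin.cons (α := fun _ => Fin d → ℝ) w W)

/-- `x / ‖x‖₂`; the zero vector, which cannot be normalized, is replaced by the first vector of the
standard basis, so that the result is always a unit vector. -/
def normalizeVec {d : ℕ} [NeZero d] (x : Fin d → ℝ) : Fin d → ℝ :=
  open Classical in if x = 0 then Pi.single 0 1 else (euclNorm x)⁻¹ • x

/-- Krylov iteration on `AAᵀ` from the starting vector `g`, with iteration count `t`: build the
Krylov matrix `K = [g, (AAᵀ) g, …, (AAᵀ)^t g]`, compute an orthonormal basis `Q` of its column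
span, query `W = AᵀQ`, compute a top eigenvector `y` of `WᵀW = QᵀAAᵀQ`, and return the vector
`AᵀQy / ‖AᵀQy‖₂`. -/
def krylovIteration {n d : ℕ} [NeZero d] (S : LinAlgSubroutines n) (t : ℕ) (g : Fin n → ℝ) :
    MatVecProgram n d (Fin d → ℝ) :=
  (krylovColumns g t).bind fun K =>
    let Q := S.basis (Matrix.of K).transpose
    (transposeColumns Q.1 Q.2.col).bind fun w =>
      let W : Matrix (Fin d) (Fin Q.1) ℝ := (Matrix.of w).transpose
      .done (normalizeVec (W.mulVec (S.topEigenvector (W.transpose * W))))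

end

/-! Let `μ i` be the eigenvalues of `AAᵀ`, `Λ` the largest one (attained at `i₀`), `x i = μ i / Λ`,
and `S` the sum of `x i ^ (p / 2)` over `i ≠ i₀`. If `v` is `Aᵀq` normalized and `c = ‖Aᵀq‖`,
deflation shows that the `p`-th power of the residual is at most `∑ σ i ^ p - c ^ p`, while Weyl's
inequality bounds every residual below by `∑ σ i ^ p - σ 0 ^ p`. So it suffices that `c ^ p ≥ Λ ^ (p
/ 2) * (1 - ε * S)`, and by Bernoulli that `c ^ 2 / Λ ≥ 1 - (ε / p) * S`: the larger the tail `S`,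
the cruder the Rayleigh quotient may be.

Krylov iteration does at least as well as any polynomial of degree `t` in `AAᵀ` applied to `g`, so
one good polynomial for the spectrum is enough (`exists_polynomial_small_or_near`). Points with `1 -
x ≤ (ε / p) * S / 2` are harmless; at all others the polynomial must be small relative to `x ^ (p /
4)`. If `S ≥ ε ^ (-1/3)`, these points lie below a gap of order `ε ^ (2/3) / p`, and a Chebyshev
polynomial of degree about `√p * ε ^ (-1/3)`, up to a logarithm, suffices. If `S < ε ^ (-1/3)`, at
most `2 * ε ^ (-1/3)` of them have `x ^ (p / 2) ≥ 1/2`. Linear factors kill those, and a Chebyshev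
polynomial for the gap `1 / (2 * p)` handles the rest and offsets the growth of the factors. The
exponent `1/3` balances the two cases.

The factor `x ^ ⌈p / 4⌉` makes the error comparable to `S`, which removes the dimension: a Gaussian
start satisfies `∑ x i ^ (p / 2) * ⟪u i, g⟫ ^ 2 ≤ 200 * S` with high probability. -/

/-! ### Polynomial filters on the unit interval -/

open Polynomial in
theorem exp_le_two_mul_eval_chebyshev (m : ℕ) {τ y : ℝ} (h0 : 0 ≤ τ) (h1 : τ ≤ 1)
    (hy : 1 + τ ≤ y) : Real.exp (m * √τ) ≤ 2 * (Chebyshev.T ℝ m).eval y := by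
  have hy1 : 1 ≤ y := by linarith
  -- `cosh √τ ≤ exp (τ / 2) ≤ 1 + τ` for `τ ≤ 1`, so `y = cosh θ` with `θ ≥ √τ`; then `T_m (cosh θ)
  -- = cosh (m * θ)`.
  have hcosh : Real.cosh (√τ) ≤ Real.cosh (Real.arcosh y) := by
    rw [Real.cosh_arcosh hy1]
    refine (Real.cosh_le_exp_half_sq _).trans (le_trans ?_ hy)
    rw [Real.sq_sqrt h0]
    have := Real.abs_exp_sub_one_sub_id_le (x := τ / 2) (by rw [abs_of_nonneg] <;> linarith)
    have := (abs_le.1 this).2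
    nlinarith
  have hθ : √τ ≤ Real.arcosh y := by
    rwa [Real.cosh_le_cosh, abs_of_nonneg (Real.sqrt_nonneg _),
      abs_of_nonneg (Real.arcosh_nonneg hy1)] at hcosh
  have hT : (Chebyshev.T ℝ m).eval y = Real.cosh (m * Real.arcosh y) := by
    have := Chebyshev.T_real_cosh (Real.arcosh y) m
    rw [Real.cosh_arcosh hy1] at this
    simpa using this
  rw [hT, Real.cosh_eq]
  have : Real.exp (m * √τ) ≤ Real.exp (m * Real.arcosh y) := by gcongr
  have := Real.exp_pos (-(m * Real.arcosh y))
  linarith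

open Polynomial in
/-- A normalized Chebyshev polynomial: `1` at `1`, and exponentially small on `[0, 1 - τ]`. -/
theorem exists_polynomial_small_below_gap (m : ℕ) {τ : ℝ} (h0 : 0 < τ) (h1 : τ < 1) :
    ∃ f : ℝ[X], f.natDegree ≤ m ∧ f.eval 1 = 1 ∧
      ∀ x, 0 ≤ x → x ≤ 1 - τ → |f.eval x| ≤ 2 * Real.exp (-(m * √τ)) := by
  have hτ : 0 < 1 - τ := by linarith
  have hy : 1 + τ ≤ (1 - τ)⁻¹ := by
    rw [← one_div, le_div_iff₀ hτ]
    nlinarith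
  have hT := exp_le_two_mul_eval_chebyshev m h0.le h1.le hy
  have he := Real.exp_pos (m * √τ)
  set c := (Chebyshev.T ℝ m).eval (1 - τ)⁻¹ with hc
  have hc0 : 0 < c := by linarith
  refine ⟨C c⁻¹ * (Chebyshev.T ℝ m).comp (C (1 - τ)⁻¹ * X), ?_, ?_, ?_⟩
  · refine (natDegree_C_mul_le _ _).trans (natDegree_comp_le.trans ?_)
    calc _ ≤ m * 1 := by
          gcongr
          · exact (Chebyshev.natDegree_T ℝ m).le
          · exact (natDegree_C_mul_le _ _).trans natDegree_X_le
      _ = m := mul_one m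
  · simp [eval_comp, ← hc, hc0.ne']
  · intro x hx0 hx1
    have hx : |(1 - τ)⁻¹ * x| ≤ 1 := by
      rw [abs_of_nonneg (by positivity), inv_mul_le_iff₀ hτ]
      linarith
    have := Chebyshev.abs_eval_T_real_le_one m hx
    simp only [eval_mul, eval_C, eval_comp, eval_X, abs_mul, abs_inv, abs_of_pos hc0]
    rw [Real.exp_neg]
    calc c⁻¹ * |(Chebyshev.T ℝ m).eval ((1 - τ)⁻¹ * x)| ≤ c⁻¹ * 1 := by gcongr
      _ ≤ 2 * (Real.exp (m * √τ))⁻¹ := by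
        rw [mul_one, ← div_eq_mul_inv, ← one_div, div_le_div_iff₀ hc0 he]
        linarith

open Polynomial in
/-- A product of normalized linear factors vanishing on `H`. -/
theorem exists_polynomial_vanishing_on (H : Finset ℝ) {K : ℝ} (hK : 1 ≤ K)
    (hH : ∀ μ ∈ H, 0 ≤ μ ∧ 1 ≤ K * (1 - μ)) :
    ∃ f : ℝ[X], f.natDegree ≤ H.card ∧ f.eval 1 = 1 ∧ (∀ x ∈ H, f.eval x = 0) ∧
      ∀ x, 0 ≤ x → x ≤ 1 → |f.eval x| ≤ K ^ H.card := by
  have hpos : ∀ μ ∈ H, 0 < 1 - μ := fun μ hμ => by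
    have := (hH μ hμ).2
    by_contra! h
    nlinarith
  refine ⟨∏ μ ∈ H, C (1 - μ)⁻¹ * (X - C μ), ?_, ?_, ?_, ?_⟩
  · refine (natDegree_prod_le _ _).trans ((Finset.sum_le_card_nsmul _ _ 1 fun μ _ => ?_).trans
      (by simp))
    exact (natDegree_C_mul_le _ _).trans (natDegree_X_sub_C_le μ)
  · rw [eval_prod]
    exact Finset.prod_eq_one fun μ hμ => by simp [(hpos μ hμ).ne']
  · intro x hx
    rw [eval_prod]
    exact Finset.prod_eq_zero hx (by simp)
  · intro x hx0 hx1
    rw [eval_prod, Finset.abs_prod, ← Finset.prod_const]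
    refine Finset.prod_le_prod (fun μ _ => abs_nonneg _) fun μ hμ => ?_
    have h1 := hpos μ hμ
    simp only [eval_mul, eval_C, eval_sub, eval_X, abs_mul, abs_inv, abs_of_pos h1]
    rw [inv_mul_le_iff₀ h1, mul_comm]
    refine le_trans (abs_le.2 ⟨?_, ?_⟩) (hH μ hμ).2 <;> linarith [(hH μ hμ).1]

-- The vanishing factor may grow to `exp (L * H.card)` away from `H`. The Chebyshev factor absorbs
-- this growth and keeps a surplus `exp (-(8 * L))`, whence `H.card + 8`; squaring gives `16 * L`.
open Polynomial in
theorem exists_polynomial_filter (a m : ℕ) (H : Finset ℝ) {L τ : ℝ} (hL : 0 ≤ L)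
    (hH : ∀ μ ∈ H, 0 ≤ μ ∧ 1 ≤ Real.exp L * (1 - μ)) (h0 : 0 < τ) (h1 : τ < 1)
    (hm : (H.card + 8) * L ≤ m * √τ) :
    ∃ f : ℝ[X], f.natDegree ≤ a + H.card + m ∧ f.eval 1 = 1 ∧
      ∀ x, 0 ≤ x → x ≤ 1 → (x ∈ H ∨ x ≤ 1 - τ) →
        f.eval x ^ 2 ≤ x ^ (2 * a) * (4 * Real.exp (-(16 * L))) := by
  obtain ⟨f, hfd, hf1, hf⟩ := exists_polynomial_small_below_gap m h0 h1
  obtain ⟨g, hgd, hg1, hg0, hg⟩ :=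
    exists_polynomial_vanishing_on H (Real.one_le_exp hL) hH
  refine ⟨X ^ a * g * f, ?_, by simp [hf1, hg1], ?_⟩
  · refine natDegree_mul_le.trans (add_le_add (natDegree_mul_le.trans (add_le_add ?_ hgd)) hfd)
    exact natDegree_X_pow_le a
  · intro x hx0 hx1 hx
    by_cases hxH : x ∈ H
    · simp only [eval_mul, hg0 x hxH]
      rw [mul_zero, zero_mul, zero_pow two_ne_zero]
      positivity
    · have hfx := hf x hx0 (hx.resolve_left hxH)
      have hgx := hg x hx0 hx1
      simp only [eval_mul, eval_pow, eval_X]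
      have : |g.eval x * f.eval x| ≤ 2 * Real.exp (-(8 * L)) := by
        rw [abs_mul]
        calc |g.eval x| * |f.eval x|
            ≤ Real.exp L ^ H.card * (2 * Real.exp (-(m * √τ))) := by gcongr
          _ = 2 * Real.exp (H.card * L - m * √τ) := by
              rw [← Real.exp_nat_mul, sub_eq_add_neg, Real.exp_add]; ring
          _ ≤ _ := by gcongr; linarith
      calc (x ^ a * g.eval x * f.eval x) ^ 2 = x ^ (2 * a) * |g.eval x * f.eval x| ^ 2 := by
            rw [sq_abs]; ring
        _ ≤ x ^ (2 * a) * (2 * Real.exp (-(8 * L))) ^ 2 := by gcongr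
        _ = _ := by
            rw [mul_pow, ← Real.exp_nat_mul]; norm_num; left; ring

/-- An iteration count that suffices for Krylov iteration. -/
noncomputable def krylovDegree (p ε : ℝ) : ℕ :=
  ⌈p / 4⌉₊ + ⌊2 * ε ^ (-(1 / 3) : ℝ)⌋₊ +
    ⌈10 * Real.log (4 * p / ε) * √(2 * p) * ε ^ (-(1 / 3) : ℝ)⌉₊

/-- The left side bounds the number of products spent with iteration count `krylovDegree p ε`. -/
theorem three_mul_krylovDegree_add_one_le {p ε : ℝ} (hp : 1 ≤ p) (hε0 : 0 < ε) (hε1 : ε < 1) :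
    3 * (krylovDegree p ε : ℝ) + 1 ≤ 1000 * (p * Real.log (2 / ε) / ε ^ (1 / 3 : ℝ)) := by
  rw [mul_div_assoc, div_eq_mul_inv (Real.log _), ← Real.rpow_neg hε0.le]
  set e := ε ^ (-(1 / 3) : ℝ) with he
  have he1 : 1 ≤ e := Real.one_le_rpow_of_pos_of_le_one_of_nonpos hε0 hε1.le (by norm_num)
  set l := Real.log (2 / ε) with hl
  have hl1 : 0.69 ≤ l := by
    have : Real.log 2 ≤ l := Real.log_le_log (by norm_num) (by
      rw [le_div_iff₀ hε0]; linarith)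
    linarith [Real.log_two_gt_d9]
  have hlog : Real.log (4 * p / ε) = l + Real.log (2 * p) := by
    rw [hl, ← Real.log_mul (by positivity) (by positivity)]
    congr 1; ring
  set s := √(2 * p) with hs
  have hs2 : s * s = 2 * p := Real.mul_self_sqrt (by positivity)
  have hs1 : 1 ≤ s := by rw [hs, Real.one_le_sqrt]; linarith
  -- The spare factor `√p` absorbs `log (2 * p)`: the degree has only `√p` in front of its
  -- logarithm, while the target allows `p`.
  have hlog2 : Real.log (2 * p) ≤ 2 * s := by
    rw [← hs2, Real.log_mul (by positivity) (by positivity)]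
    linarith [Real.log_le_sub_one_of_pos (show 0 < s by positivity)]
  have h1 : (⌈p / 4⌉₊ : ℝ) ≤ p / 4 + 1 := (Nat.ceil_lt_add_one (by positivity)).le
  have h2 : (⌊2 * e⌋₊ : ℝ) ≤ 2 * e := Nat.floor_le (by positivity)
  have hL0 : 0 ≤ Real.log (4 * p / ε) := by
    rw [hlog]
    have := Real.log_nonneg (show 1 ≤ 2 * p by linarith)
    linarith
  have h3 : (⌈10 * Real.log (4 * p / ε) * s * e⌉₊ : ℝ) ≤ 10 * Real.log (4 * p / ε) * s * e + 1 :=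
    (Nat.ceil_lt_add_one (by positivity)).le
  have h4 : Real.log (4 * p / ε) * s ≤ 2 * p * l + 4 * p := by
    have h41 : l * (s * 1) ≤ l * (s * s) := by gcongr
    have h42 : Real.log (2 * p) * s ≤ 2 * s * s := by gcongr
    rw [hlog, add_mul]
    nlinarith
  have h5 : 10 * Real.log (4 * p / ε) * s * e ≤ 10 * (2 * p * l + 4 * p) * e := by
    rw [mul_assoc 10]; gcongr
  have hpe : p * 1 ≤ p * e := by gcongr
  have h6 : 1 * e ≤ p * e := by gcongr
  have h7 : 0.69 * (p * e) ≤ l * (p * e) := by gcongr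
  rw [krylovDegree]
  push_cast
  nlinarith

/-- Contrapositively, a point with `x ^ (p / 2) < 1/2` lies below `1 - 1 / (2 * p)`, so Chebyshev
can treat it. Bernoulli needs exponent at least `1`; for `p ≤ 2` the base is already at least `1/2`.
-/
theorem one_half_le_one_sub_rpow {p : ℝ} (hp : 1 ≤ p) :
    1 / 2 ≤ (1 - 1 / (2 * p)) ^ (p / 2) := by
  have h0 : 1 / (2 * p) ≤ 1 / 2 := by gcongr; linarith
  have h0' : 0 < 1 / (2 * p) := by positivity
  rcases le_total 2 p with h | h
  · have := one_add_mul_self_le_rpow_one_add (s := -(1 / (2 * p))) (by linarith)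
      (p := p / 2) (by linarith)
    rw [sub_eq_add_neg]
    refine le_trans ?_ this
    have : p / 2 * -(1 / (2 * p)) = -(1 / 4) := by field_simp; norm_num
    rw [this]; norm_num
  · calc (1 : ℝ) / 2 ≤ (1 - 1 / (2 * p)) ^ (1 : ℝ) := by rw [Real.rpow_one]; linarith
      _ ≤ _ := Real.rpow_le_rpow_of_exponent_ge (by linarith) (by linarith) (by linarith)

open Polynomial in
/-- A polynomial of degree `krylovDegree p ε` that is small, relative to `x ^ (p / 2)`, at all
points of a family that are not already close to `1`. -/
theorem exists_polynomial_small_or_near {ι : Type*} [Fintype ι] {p ε : ℝ} (hp : 1 ≤ p)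
    (hε0 : 0 < ε) (hε1 : ε < 1) (s : Finset ι) (x : ι → ℝ) (hx0 : ∀ i, 0 ≤ x i)
    (hx1 : ∀ i, x i ≤ 1) :
    ∃ f : ℝ[X], f.natDegree ≤ krylovDegree p ε ∧ f.eval 1 = 1 ∧
      ∀ i ∈ s, 1 - x i ≤ ε / p * (∑ j ∈ s, x j ^ (p / 2)) / 2 ∨
        f.eval (x i) ^ 2 ≤ x i ^ (p / 2) * (ε / p / 16000000) := by
  classical
  set S := ∑ j ∈ s, x j ^ (p / 2) with hS
  have hxp : ∀ i, 0 ≤ x i ^ (p / 2) := fun i => Real.rpow_nonneg (hx0 i) _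
  have hS0 : 0 ≤ S := Finset.sum_nonneg fun i _ => hxp i
  set η := ε / p with hη
  have hη0 : 0 < η := by positivity
  have hη1 : η ≤ 1 := by rw [hη, div_le_one (by positivity)]; linarith
  set e := ε ^ (-(1 / 3) : ℝ) with he
  have he1 : 1 ≤ e := Real.one_le_rpow_of_pos_of_le_one_of_nonpos hε0 hε1.le (by norm_num)
  have he3 : e ^ 3 * ε = 1 := by
    rw [he, ← Real.rpow_natCast, ← Real.rpow_mul hε0.le]
    norm_num
    rw [Real.rpow_neg_one, inv_mul_cancel₀ hε0.ne']
  set L := Real.log (4 * p / ε) with hL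
  have hexpL : Real.exp L = 4 / η := by
    rw [hL, Real.exp_log (by positivity), hη]; field_simp
  have hL0 : 0 ≤ L := by
    rw [← Real.one_le_exp_iff, hexpL, le_div_iff₀ hη0]; linarith
  have hL16 : 4 * Real.exp (-(16 * L)) ≤ η / 16000000 := by
    have h1 : Real.exp (-(16 * L)) = (η / 4) ^ 16 := by
      rw [Real.exp_neg, show 16 * L = ((16 : ℕ) : ℝ) * L by norm_num, Real.exp_nat_mul, hexpL,
        ← inv_pow, inv_div]
    have h2 : η ^ 16 ≤ η := pow_le_of_le_one hη0.le hη1 (by norm_num)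
    rw [h1, div_pow]
    norm_num
    linarith
  set r := √(2 * p) with hr
  have hr0 : 0 < r := by positivity
  set m := ⌈10 * L * r * e⌉₊ with hm
  have hme : 10 * L * r * e ≤ m := Nat.le_ceil _
  set a := ⌈p / 4⌉₊ with ha
  have hpow : ∀ i, x i ^ (2 * a) ≤ x i ^ (p / 2) := fun i => by
    rw [← Real.rpow_natCast]
    refine Real.rpow_le_rpow_of_exponent_ge' (hx0 i) (hx1 i) (by positivity) ?_
    push_cast
    have : p / 4 ≤ a := Nat.le_ceil _
    linarith
  have hfin : ∀ (H : Finset ℝ) (τ : ℝ), (∀ μ ∈ H, 0 ≤ μ ∧ 1 ≤ Real.exp L * (1 - μ)) → 0 < τ →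
      τ < 1 → (H.card : ℝ) ≤ 2 * e → (H.card + 8) * L ≤ m * √τ →
      (∀ i ∈ s, 1 - x i ≤ η * S / 2 ∨ x i ∈ H ∨ x i ≤ 1 - τ) →
      ∃ f : ℝ[X], f.natDegree ≤ krylovDegree p ε ∧ f.eval 1 = 1 ∧
      ∀ i ∈ s, 1 - x i ≤ η * S / 2 ∨ f.eval (x i) ^ 2 ≤ x i ^ (p / 2) * (η / 16000000) := by
    intro H τ hH h0 h1 hcard hmτ hcase
    obtain ⟨f, hfd, hf1, hf⟩ := exists_polynomial_filter a m H hL0 hH h0 h1 hmτ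
    refine ⟨f, hfd.trans ?_, hf1, fun i hi => ?_⟩
    · rw [krylovDegree]
      gcongr
      exact Nat.le_floor hcard
    · rcases hcase i hi with h | h
      · exact .inl h
      · refine .inr ((hf _ (hx0 i) (hx1 i) h).trans ?_)
        exact mul_le_mul (hpow i) hL16 (by positivity) (hxp i)
  -- Heavy tail: Chebyshev alone. Light tail: few points near `1`, removed one by one.
  rcases le_or_gt e S with hcase | hcase
  · have hτr : √(1 / (2 * p * e ^ 2)) = 1 / (r * e) := by
      rw [Real.sqrt_div zero_le_one, Real.sqrt_one, Real.sqrt_mul (by positivity),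
        Real.sqrt_sq (by positivity)]
    refine hfin ∅ (1 / (2 * p * e ^ 2)) (by simp) (by positivity) ?_ (by simp; positivity) ?_ ?_
    · rw [div_lt_one (by positivity)]
      nlinarith
    · rw [hτr, mul_one_div, le_div_iff₀ (by positivity)]
      simp only [Finset.card_empty, Nat.cast_zero, zero_add]
      have : 0 ≤ L * (r * e) := by positivity
      nlinarith
    · intro i _
      by_cases h : 1 - x i ≤ η * S / 2
      · exact .inl h
      · right; right
        -- This is `e ^ 3 * ε = 1`: the gap chosen for degree of order `e` is the distance tolerated
        -- when `S ≥ e`.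
        have h1 : 1 / (2 * p * e ^ 2) = η * e / 2 := by
          rw [hη, div_eq_div_iff (by positivity) (by positivity)]
          field_simp
          linarith
        have : η * e ≤ η * S := by gcongr
        rw [h1]; linarith
  · have hτr : √(1 / (2 * p)) = 1 / r := by rw [Real.sqrt_div zero_le_one, Real.sqrt_one]
    set F := s.filter fun i => 1 / 2 ≤ x i ^ (p / 2) ∧ η * S / 2 < 1 - x i with hF
    have hFS : (F.card : ℝ) * (1 / 2) ≤ S := by
      rw [← nsmul_eq_mul]
      refine (Finset.card_nsmul_le_sum F _ _ fun i hi => (Finset.mem_filter.1 hi).2.1).trans ?_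
      exact Finset.sum_le_sum_of_subset_of_nonneg (Finset.filter_subset _ _) fun i _ _ => hxp i
    have hcard : ((F.image x).card : ℝ) ≤ 2 * e := by
      have : ((F.image x).card : ℝ) ≤ F.card := by exact_mod_cast Finset.card_image_le
      linarith
    refine hfin (F.image x) (1 / (2 * p)) ?_ (by positivity) ?_ hcard ?_ ?_
    · intro μ hμ
      obtain ⟨i, hi, rfl⟩ := Finset.mem_image.1 hμ
      refine ⟨hx0 i, ?_⟩
      -- A single member of `F` forces `S ≥ 1/2`, so its distance from `1` exceeds `η / 4 = exp
      -- (-L)`.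
      have h1 : (1 : ℝ) ≤ F.card := by exact_mod_cast Finset.card_pos.2 ⟨i, hi⟩
      have h2 := (Finset.mem_filter.1 hi).2.2
      rw [hexpL, div_mul_eq_mul_div, le_div_iff₀ hη0]
      nlinarith
    · rw [div_lt_one (by positivity)]; linarith
    · rw [hτr, mul_one_div, le_div_iff₀ hr0]
      calc ((F.image x).card + 8) * L * r ≤ (2 * e + 8 * e) * L * r := by
            gcongr; linarith
        _ = 10 * L * r * e := by ring
        _ ≤ m := hme
    · intro i hi
      by_cases h : 1 - x i ≤ η * S / 2
      · exact .inl h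
      by_cases h2 : 1 / 2 ≤ x i ^ (p / 2)
      · exact .inr (.inl (Finset.mem_image_of_mem x
          (Finset.mem_filter.2 ⟨hi, h2, not_le.1 h⟩)))
      · right; right
        by_contra! h3
        refine h2 ((one_half_le_one_sub_rpow hp).trans ?_)
        have : 1 / (2 * p) ≤ 1 := by rw [div_le_one (by positivity)]; linarith
        exact Real.rpow_le_rpow (by linarith) h3.le (by positivity)

-- Near points cost at most half of the allowed error, by their distance from `1`. Far points cost
-- at most `(ε / p) * S / 80000`, which the weight at `i₀` pays for. The filter depends on the `x i`
-- only, so it is unaffected by the random weights.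
open Polynomial in
theorem exists_polynomial_weighted_residual_le {ι : Type*} [Fintype ι] [DecidableEq ι] {p ε : ℝ}
    (hp : 1 ≤ p) (hε0 : 0 < ε) (hε1 : ε < 1) (i₀ : ι) (x w : ι → ℝ) (hx0 : ∀ i, 0 ≤ x i)
    (hx1 : ∀ i, x i ≤ 1) (hi₀ : x i₀ = 1) (hw : ∀ i, 0 ≤ w i) (hw₀ : 1 / 40000 ≤ w i₀)
    (hsum : ∑ i ∈ Finset.univ.erase i₀, x i ^ (p / 2) * w i ≤
      200 * ∑ i ∈ Finset.univ.erase i₀, x i ^ (p / 2)) :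
    ∃ f : ℝ[X], f.natDegree ≤ krylovDegree p ε ∧ f.eval 1 = 1 ∧
      ∑ i, (1 - x i) * (f.eval (x i) ^ 2 * w i) ≤
        ε / p * (∑ i ∈ Finset.univ.erase i₀, x i ^ (p / 2)) *
          ∑ i, f.eval (x i) ^ 2 * w i := by
  obtain ⟨f, hfd, hf1, hf⟩ := exists_polynomial_small_or_near hp hε0 hε1 (Finset.univ.erase i₀)
    x hx0 hx1
  refine ⟨f, hfd, hf1, ?_⟩
  set S := ∑ i ∈ Finset.univ.erase i₀, x i ^ (p / 2) with hS
  have hS0 : 0 ≤ S := Finset.sum_nonneg fun i _ => Real.rpow_nonneg (hx0 i) _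
  have hη0 : 0 < ε / p := by positivity
  have hterm : ∀ i ∈ Finset.univ.erase i₀, (1 - x i) * (f.eval (x i) ^ 2 * w i) ≤
      ε / p * S / 2 * (f.eval (x i) ^ 2 * w i) +
        ε / p / 16000000 * (x i ^ (p / 2) * w i) := by
    intro i hi
    have h1 : 0 ≤ f.eval (x i) ^ 2 * w i := mul_nonneg (sq_nonneg _) (hw i)
    have h2 : 0 ≤ x i ^ (p / 2) * w i := mul_nonneg (Real.rpow_nonneg (hx0 i) _) (hw i)
    rcases hf i hi with h | h
    · have := mul_le_mul_of_nonneg_right h h1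
      have : 0 ≤ ε / p / 16000000 * (x i ^ (p / 2) * w i) := by positivity
      linarith
    · have h3 := mul_le_mul_of_nonneg_right h (hw i)
      have h4 : (1 - x i) * (f.eval (x i) ^ 2 * w i) ≤ 1 * (f.eval (x i) ^ 2 * w i) := by
        gcongr; linarith [hx0 i]
      have : 0 ≤ ε / p * S / 2 * (f.eval (x i) ^ 2 * w i) := by positivity
      linarith
  have hw' : w i₀ + ∑ i ∈ Finset.univ.erase i₀, f.eval (x i) ^ 2 * w i =
      ∑ i, f.eval (x i) ^ 2 * w i := by
    rw [← Finset.add_sum_erase _ _ (Finset.mem_univ i₀), hi₀, hf1]; ring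
  rw [← Finset.add_sum_erase _ _ (Finset.mem_univ i₀), hi₀, sub_self, zero_mul, zero_add]
  refine (Finset.sum_le_sum hterm).trans ?_
  rw [Finset.sum_add_distrib, ← Finset.mul_sum, ← Finset.mul_sum, ← hw']
  have h0 : 0 ≤ ∑ i ∈ Finset.univ.erase i₀, f.eval (x i) ^ 2 * w i :=
    Finset.sum_nonneg fun i _ => mul_nonneg (sq_nonneg _) (hw i)
  -- `200 / 16000000` is half of `1 / 40000`.
  have h1 : ε / p / 16000000 * ∑ i ∈ Finset.univ.erase i₀, x i ^ (p / 2) * w i ≤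
      ε / p / 16000000 * (200 * S) := by gcongr
  have h2 : ε / p * S * (1 / 40000) ≤ ε / p * S * w i₀ := by gcongr
  have h3 : 0 ≤ ε / p * S * ∑ i ∈ Finset.univ.erase i₀, f.eval (x i) ^ 2 * w i := by positivity
  nlinarith

/-! ### Singular value inequalities: diagonals, Weyl, deflation -/

/-- Jensen, with the missing mass placed at the value `0` through `Option`. -/
theorem rpow_sum_mul_le_of_sum_le_one {ι : Type*} [Fintype ι] {p : ℝ} (hp : 1 ≤ p) (w s : ι → ℝ)
    (hw : ∀ i, 0 ≤ w i) (hw1 : ∑ i, w i ≤ 1) (hs : ∀ i, 0 ≤ s i) :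
    (∑ i, w i * s i) ^ p ≤ ∑ i, w i * s i ^ p := by
  have := Real.rpow_arith_mean_le_arith_mean_rpow (Finset.univ : Finset (Option ι))
    (fun o => o.elim (1 - ∑ i, w i) w) (fun o => o.elim 0 s)
    (by rintro (_ | i) _ <;> simp [hw, hw1]) (by simp [Fintype.sum_option])
    (by rintro (_ | i) _ <;> simp [hs]) hp
  simpa [Fintype.sum_option, Real.zero_rpow (show p ≠ 0 by linarith)] using this

theorem Fintype.sum_subtype_of_eq_zero {ι : Type*} [Fintype ι] (P : ι → Prop) [DecidablePred P]
    (f : ι → ℝ) (h : ∀ i, ¬ P i → f i = 0) : ∑ i : {i // P i}, f i = ∑ i, f i := by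
  rw [← Finset.sum_subtype (Finset.univ.filter P) (by simp) f]
  exact Finset.sum_filter_of_ne fun i _ hi => by_contra fun hP => hi (h i hP)

namespace LinearMap

open scoped RealInnerProductSpace

variable {E F : Type*} [NormedAddCommGroup E] [InnerProductSpace ℝ E] [FiniteDimensional ℝ E]
  [NormedAddCommGroup F] [InnerProductSpace ℝ F] [FiniteDimensional ℝ F]

/-- An orthonormal basis of right singular vectors. -/
noncomputable def rightSingularBasis (T : E →ₗ[ℝ] F) {d : ℕ} (hd : Module.finrank ℝ E = d) :
    OrthonormalBasis (Fin d) ℝ E :=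
  T.isSymmetric_adjoint_comp_self.eigenvectorBasis hd

theorem adjoint_apply_rightSingularBasis (T : E →ₗ[ℝ] F) {d : ℕ} (hd : Module.finrank ℝ E = d)
    (i : Fin d) : adjoint T (T (T.rightSingularBasis hd i)) =
      T.singularValues i ^ 2 • T.rightSingularBasis hd i := by
  have := T.isSymmetric_adjoint_comp_self.apply_eigenvectorBasis hd i
  rw [T.sq_singularValues_fin hd]
  exact this

theorem inner_apply_rightSingularBasis (T : E →ₗ[ℝ] F) {d : ℕ} (hd : Module.finrank ℝ E = d)
    (i : Fin d) (x : E) : ⟪T (T.rightSingularBasis hd i), T x⟫ =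
      T.singularValues i ^ 2 * ⟪T.rightSingularBasis hd i, x⟫ := by
  rw [← adjoint_inner_left, adjoint_apply_rightSingularBasis, real_inner_smul_left]

theorem norm_apply_rightSingularBasis (T : E →ₗ[ℝ] F) {d : ℕ} (hd : Module.finrank ℝ E = d)
    (i : Fin d) : ‖T (T.rightSingularBasis hd i)‖ = T.singularValues i := by
  have := T.inner_apply_rightSingularBasis hd i (T.rightSingularBasis hd i)
  rw [real_inner_self_eq_norm_sq, real_inner_self_eq_norm_sq,
    (T.rightSingularBasis hd).orthonormal.1 i, one_pow, mul_one] at this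
  exact (sq_eq_sq₀ (norm_nonneg _) (T.singularValues_nonneg i)).1 this

theorem norm_sq_apply_eq_sum_singularValues (T : E →ₗ[ℝ] F) {d : ℕ}
    (hd : Module.finrank ℝ E = d) (x : E) :
    ‖T x‖ ^ 2 = ∑ i : Fin d, T.singularValues i ^ 2 * ⟪T.rightSingularBasis hd i, x⟫ ^ 2 := by
  have hx := congrArg T ((T.rightSingularBasis hd).sum_repr' x)
  rw [map_sum] at hx
  rw [← real_inner_self_eq_norm_sq]
  nth_rw 1 [← hx]
  rw [sum_inner]
  refine Finset.sum_congr rfl fun i _ => ?_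
  rw [map_smul, real_inner_smul_left, inner_apply_rightSingularBasis]
  ring

/-- Left singular vectors; those for the singular value `0` are set to `0`. -/
noncomputable def leftSingularVector (T : E →ₗ[ℝ] F) {d : ℕ} (hd : Module.finrank ℝ E = d)
    (i : Fin d) : F :=
  (T.singularValues i)⁻¹ • T (T.rightSingularBasis hd i)

theorem apply_rightSingularBasis (T : E →ₗ[ℝ] F) {d : ℕ} (hd : Module.finrank ℝ E = d)
    (i : Fin d) : T (T.rightSingularBasis hd i) =
      T.singularValues i • T.leftSingularVector hd i := by
  by_cases h : T.singularValues i = 0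
  · rw [h, zero_smul, ← norm_eq_zero, norm_apply_rightSingularBasis, h]
  · rw [leftSingularVector, smul_inv_smul₀ h]

theorem orthonormal_leftSingularVector (T : E →ₗ[ℝ] F) {d : ℕ} (hd : Module.finrank ℝ E = d) :
    Orthonormal ℝ fun i : {i : Fin d // T.singularValues i ≠ 0} =>
      T.leftSingularVector hd (i : Fin d) := by
  classical
  rw [orthonormal_iff_ite]
  rintro ⟨i, hi⟩ ⟨j, hj⟩
  simp only [leftSingularVector, real_inner_smul_left, real_inner_smul_right,
    inner_apply_rightSingularBasis, orthonormal_iff_ite.1 (T.rightSingularBasis hd).orthonormal,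
    Subtype.mk.injEq]
  split_ifs with h
  · subst h; field_simp
  · simp

theorem sum_sq_inner_leftSingularVector_le (T : E →ₗ[ℝ] F) {d : ℕ}
    (hd : Module.finrank ℝ E = d) (x : F) :
    ∑ i, ⟪T.leftSingularVector hd i, x⟫ ^ 2 ≤ ‖x‖ ^ 2 := by
  classical
  have h := (T.orthonormal_leftSingularVector hd).sum_inner_products_le (s := Finset.univ) x
  simp only [Real.norm_eq_abs, sq_abs] at h
  refine le_trans (le_of_eq ?_) h
  refine (Fintype.sum_subtype_of_eq_zero _ (fun i => ⟪T.leftSingularVector hd i, x⟫ ^ 2)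
    fun i hi => ?_).symm
  simp [leftSingularVector, not_not.1 hi]

/-- The diagonal of a linear map with respect to two orthonormal families is dominated, in the
`ℓ_p` sense, by the singular values. -/
theorem sum_abs_inner_rpow_le_sum_singularValues (T : E →ₗ[ℝ] F) {d : ℕ}
    (hd : Module.finrank ℝ E = d) {p : ℝ} (hp : 1 ≤ p) {κ : Type*} [Fintype κ] {x : κ → F}
    {y : κ → E} (hx : Orthonormal ℝ x) (hy : Orthonormal ℝ y) :
    ∑ k, |⟪x k, T (y k)⟫| ^ p ≤ ∑ i : Fin d, T.singularValues i ^ p := by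
  set b := T.rightSingularBasis hd with hb
  set a := T.leftSingularVector hd with ha
  -- By AM-GM these weights dominate `|⟪a i, x k⟫ * ⟪b i, y k⟫|`. Bessel makes their row sums, and
  -- their column sums at nonzero singular values, at most `1`; Jensen along rows and summation
  -- along columns then finish.
  set w : κ → Fin d → ℝ := fun k i => (⟪a i, x k⟫ ^ 2 + ⟪b i, y k⟫ ^ 2) / 2 with hw
  have hw0 : ∀ k i, 0 ≤ w k i := fun k i => by positivity
  have hw1 : ∀ k, ∑ i, w k i ≤ 1 := by
    intro k
    have h1 := T.sum_sq_inner_leftSingularVector_le hd (x k)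
    have h2 := b.orthonormal.sum_inner_products_le (s := Finset.univ) (y k)
    simp only [Real.norm_eq_abs, sq_abs] at h2
    rw [hx.1 k] at h1
    rw [hy.1 k] at h2
    rw [← Finset.sum_div, Finset.sum_add_distrib]
    linarith
  have hw2 : ∀ i : Fin d, T.singularValues i ≠ 0 → ∑ k, w k i ≤ 1 := by
    intro i hi
    have h1 := hx.sum_inner_products_le (s := Finset.univ) (a i)
    have h2 := hy.sum_inner_products_le (s := Finset.univ) (b i)
    have h3 : ‖a i‖ = 1 := (T.orthonormal_leftSingularVector hd).1 ⟨i, hi⟩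
    rw [h3] at h1
    rw [b.orthonormal.1 i] at h2
    simp only [Real.norm_eq_abs, sq_abs] at h1 h2
    rw [← Finset.sum_div, Finset.sum_add_distrib]
    simp only [real_inner_comm] at h1 h2 ⊢
    linarith
  have hexp : ∀ k, ⟪x k, T (y k)⟫ =
      ∑ i : Fin d, T.singularValues i * (⟪a i, x k⟫ * ⟪b i, y k⟫) := by
    intro k
    conv_lhs => rw [← b.sum_repr' (y k), map_sum, inner_sum]
    refine Finset.sum_congr rfl fun i _ => ?_
    rw [map_smul, hb, apply_rightSingularBasis, real_inner_smul_right, real_inner_smul_right,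
      real_inner_comm (a i)]
    ring
  have hle : ∀ k, |⟪x k, T (y k)⟫| ^ p ≤ ∑ i : Fin d, w k i * T.singularValues i ^ p := by
    intro k
    refine le_trans ?_ (rpow_sum_mul_le_of_sum_le_one hp (w k) (fun i => T.singularValues i)
      (hw0 k) (hw1 k) fun i => T.singularValues_nonneg i)
    refine Real.rpow_le_rpow (abs_nonneg _) ?_ (by linarith)
    rw [hexp]
    refine (Finset.abs_sum_le_sum_abs _ _).trans (Finset.sum_le_sum fun i _ => ?_)
    rw [abs_mul, abs_of_nonneg (T.singularValues_nonneg i), mul_comm, abs_mul]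
    refine mul_le_mul_of_nonneg_right ?_ (T.singularValues_nonneg i)
    have := two_mul_le_add_sq |⟪a i, x k⟫| |⟪b i, y k⟫|
    rw [sq_abs, sq_abs] at this
    simp only [hw]
    linarith
  refine (Finset.sum_le_sum fun k _ => hle k).trans ?_
  rw [Finset.sum_comm]
  refine Finset.sum_le_sum fun i _ => ?_
  rw [← Finset.sum_mul]
  by_cases hi : T.singularValues i = 0
  · rw [hi, Real.zero_rpow (by linarith), mul_zero]
  · exact mul_le_of_le_one_left (Real.rpow_nonneg (T.singularValues_nonneg i) _) (hw2 i hi)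

/-- Weyl's inequality for a perturbation of rank one. -/
theorem singularValues_succ_le_of_eq_on_orthogonal {T T' : E →ₗ[ℝ] F} {u : E}
    (h : ∀ x, ⟪u, x⟫ = 0 → T' x = T x) (i : ℕ) :
    T.singularValues (i + 1) ≤ T'.singularValues i := by
  by_cases hi : Module.finrank ℝ E ≤ i + 1
  · rw [T.singularValues_of_finrank_le hi]
    exact T'.singularValues_nonneg i
  push Not at hi
  set d := Module.finrank ℝ E with hd
  set b := T.rightSingularBasis hd.symm with hb
  set b' := T'.rightSingularBasis hd.symm with hb'
  -- Dimension count: the span of the first `i + 2` right singular vectors of `T` contains a nonzero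
  -- vector meeting `i + 1` linear conditions, orthogonality to `u` and to the first `i` right
  -- singular vectors of `T'`.
  let X : (Fin (i + 2) → ℝ) →ₗ[ℝ] E :=
    Fintype.linearCombination ℝ fun k => b (Fin.castLE (by omega) k)
  let L : (Fin (i + 2) → ℝ) →ₗ[ℝ] (Fin (i + 1) → ℝ) := LinearMap.pi
    (Fin.cases ((innerₛₗ ℝ u).comp X)
      fun j : Fin i => (innerₛₗ ℝ (b' (Fin.castLE (by omega) j))).comp X)
  obtain ⟨c, hc, hc0⟩ := Submodule.exists_mem_ne_zero_of_ne_bot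
    (LinearMap.ker_ne_bot_of_finrank_lt (f := L) (by simp))
  have hX : X c = ∑ k, c k • b (Fin.castLE (by omega) k) := Fintype.linearCombination_apply ..
  have hLc : ∀ k, L c k = 0 := fun k => congrFun (LinearMap.mem_ker.1 hc) k
  have hu : ⟪u, X c⟫ = 0 := hLc 0
  have hj : ∀ j : Fin d, (j : ℕ) < i → ⟪b' j, X c⟫ = 0 := fun j hji => hLc (Fin.succ ⟨j, hji⟩)
  have hk : ∀ k : Fin d, i + 1 < (k : ℕ) → ⟪b k, X c⟫ = 0 := by
    intro k hk
    rw [hX, inner_sum]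
    refine Finset.sum_eq_zero fun l _ => ?_
    rw [real_inner_smul_right, b.orthonormal.2, mul_zero]
    intro h
    have := congrArg Fin.val h
    simp at this
    omega
  have hxn : 0 < ‖X c‖ ^ 2 := by
    have : X c ≠ 0 := by
      intro h0
      apply hc0
      have hli : LinearIndependent ℝ fun k : Fin (i + 2) => b (Fin.castLE (by omega) k) :=
        b.orthonormal.linearIndependent.comp _ (Fin.castLE_injective _)
      exact funext (Fintype.linearIndependent_iff.1 hli c (hX ▸ h0))
    positivity
  have h1 : T.singularValues (i + 1) ^ 2 * ‖X c‖ ^ 2 ≤ ‖T (X c)‖ ^ 2 := by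
    rw [T.norm_sq_apply_eq_sum_singularValues hd.symm, ← b.sum_sq_inner_right (X c),
      Finset.mul_sum]
    refine Finset.sum_le_sum fun k _ => ?_
    by_cases hki : i + 1 < (k : ℕ)
    · rw [hk k hki]; simp
    · have h1 := T.singularValues_antitone (not_lt.1 hki)
      have h2 := T.singularValues_nonneg (i + 1)
      gcongr
  have h2 : ‖T' (X c)‖ ^ 2 ≤ T'.singularValues i ^ 2 * ‖X c‖ ^ 2 := by
    rw [T'.norm_sq_apply_eq_sum_singularValues hd.symm, ← b'.sum_sq_inner_right (X c),
      Finset.mul_sum]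
    refine Finset.sum_le_sum fun k _ => ?_
    by_cases hki : (k : ℕ) < i
    · rw [hj k hki]; simp
    · have h1 := T'.singularValues_antitone (not_lt.1 hki)
      have h2 := T'.singularValues_nonneg k
      gcongr
  rw [h _ hu] at h2
  exact (sq_le_sq₀ (T.singularValues_nonneg _) (T'.singularValues_nonneg _)).1
    (le_of_mul_le_mul_right (h1.trans h2) hxn)

theorem sum_singularValues_rpow_le_of_eq_on_orthogonal {T T' : E →ₗ[ℝ] F} {u : E}
    (h : ∀ x, ⟪u, x⟫ = 0 → T' x = T x) {p : ℝ} (hp : 0 ≤ p) (d : ℕ) :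
    ∑ i : Fin d, T.singularValues i ^ p ≤
      T.singularValues 0 ^ p + ∑ i : Fin d, T'.singularValues i ^ p := by
  cases d with
  | zero => simpa using Real.rpow_nonneg (T.singularValues_nonneg 0) p
  | succ d =>
    rw [Fin.sum_univ_succ, Fin.sum_univ_castSucc (n := d)
      (f := fun i => T'.singularValues (i : ℕ) ^ p)]
    have h1 : ∑ i : Fin d, T.singularValues ((i : ℕ) + 1) ^ p ≤
        ∑ i : Fin d, T'.singularValues (i : ℕ) ^ p := Finset.sum_le_sum fun i _ =>
      Real.rpow_le_rpow (T.singularValues_nonneg _)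
        (singularValues_succ_le_of_eq_on_orthogonal h i) hp
    have h2 := Real.rpow_nonneg (T'.singularValues_nonneg d) p
    simp only [Fin.val_zero, Fin.val_succ, Fin.val_castSucc, Fin.val_last]
    linarith

/-- Deflation: projecting away `v`, where `Tᵀ q = c v`, lowers the sum of the `p`-th powers of the
singular values by at least `c ^ p`. -/
theorem sum_singularValues_rpow_add_le_of_adjoint_eq_smul {T B : E →ₗ[ℝ] F} {d : ℕ}
    (hd : Module.finrank ℝ E = d) {p : ℝ} (hp : 1 ≤ p) {q : F} {v : E} {c : ℝ} (hc : 0 ≤ c)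
    (hq : ‖q‖ = 1) (hv : ‖v‖ = 1) (hqv : adjoint T q = c • v)
    (hB : ∀ x, B x = T (x - ⟪v, x⟫ • v)) :
    ∑ i : Fin d, B.singularValues i ^ p + c ^ p ≤ ∑ i : Fin d, T.singularValues i ^ p := by
  classical
  set b := B.rightSingularBasis hd with hb
  have hvv : ⟪v, v⟫ = 1 := by rw [real_inner_self_eq_norm_sq, hv, one_pow]
  have hBv : B v = 0 := by rw [hB, hvv, one_smul, sub_self, map_zero]
  have hqB : ∀ x, ⟪q, B x⟫ = 0 := fun x => by
    rw [hB, ← adjoint_inner_left, hqv, real_inner_smul_left, inner_sub_right,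
      real_inner_smul_right, hvv, mul_one, sub_self, mul_zero]
  have hvb : ∀ i : Fin d, B.singularValues i ≠ 0 → ⟪v, b i⟫ = 0 := fun i hi => by
    have := B.inner_apply_rightSingularBasis hd i v
    rw [hBv, inner_zero_right] at this
    rw [real_inner_comm]
    exact (mul_eq_zero.1 this.symm).resolve_left (pow_ne_zero 2 hi)
  -- Adjoining `q` and `v` to the singular vectors of `B` keeps both families orthonormal, since `q`
  -- is orthogonal to the range of `B` and `B v = 0`. The diagonal of `T` in them consists of `c`
  -- and the nonzero singular values of `B`.
  let x : Option {i : Fin d // B.singularValues i ≠ 0} → F :=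
    fun o => o.elim q fun i => B.leftSingularVector hd i
  let y : Option {i : Fin d // B.singularValues i ≠ 0} → E := fun o => o.elim v fun i => b i
  have hql : ∀ i : Fin d, ⟪q, B.leftSingularVector hd i⟫ = 0 := fun i => by
    rw [leftSingularVector, real_inner_smul_right, hqB, mul_zero]
  have hx : Orthonormal ℝ x := by
    refine ⟨?_, ?_⟩
    · rintro (_ | i)
      · exact hq
      · exact (B.orthonormal_leftSingularVector hd).1 i
    · rintro (_ | i) (_ | j) hij
      · exact absurd rfl hij
      · exact hql j
      · exact (real_inner_comm _ _).trans (hql i)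
      · exact (B.orthonormal_leftSingularVector hd).2 fun h => hij (congrArg some h)
  have hy : Orthonormal ℝ y := by
    refine ⟨?_, ?_⟩
    · rintro (_ | i)
      · exact hv
      · exact b.orthonormal.1 i
    · rintro (_ | i) (_ | j) hij
      · exact absurd rfl hij
      · exact hvb j j.2
      · exact (real_inner_comm _ _).trans (hvb i i.2)
      · exact b.orthonormal.2 fun h => hij (congrArg some (Subtype.ext h))
  have key := T.sum_abs_inner_rpow_le_sum_singularValues hd hp hx hy
  rw [Fintype.sum_option] at key
  refine le_trans (le_of_eq ?_) key
  have h1 : |⟪x none, T (y none)⟫| = c := by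
    change |⟪q, T v⟫| = c
    rw [← adjoint_inner_left, hqv, real_inner_smul_left, hvv, mul_one, abs_of_nonneg hc]
  have h2 : ∀ i : {i : Fin d // B.singularValues i ≠ 0},
      |⟪x (some i), T (y (some i))⟫| = B.singularValues (i : Fin d) := fun i => by
    change |⟪B.leftSingularVector hd i, T (b i)⟫| = _
    have : T (b i) = B (b i) := by rw [hB, hvb i i.2, zero_smul, sub_zero]
    have hn := (B.orthonormal_leftSingularVector hd).1 i
    rw [this, hb, apply_rightSingularBasis, real_inner_smul_right, real_inner_self_eq_norm_sq, hn,
      one_pow, mul_one, abs_of_nonneg (B.singularValues_nonneg _)]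
  rw [h1, add_comm]
  simp only [h2]
  congr 1
  refine (Fintype.sum_subtype_of_eq_zero _ (fun i : Fin d => B.singularValues i ^ p)
    fun i hi => ?_).symm
  rw [not_not.1 hi, Real.zero_rpow (by linarith)]

/-- Together with `sq_singularValues_zero_le` this is all that is needed to compare the spectrum of
`T T*` with the singular values of `T`; matching the two lists, of different lengths, is avoided.
The diagonal inequality is applied to `u i` and the normalized `T* (u i)`. -/
theorem sum_eigenvalues_rpow_le_sum_singularValues (T : E →ₗ[ℝ] F) {d : ℕ}
    (hd : Module.finrank ℝ E = d) {p : ℝ} (hp : 1 ≤ p) {ι : Type*} [Fintype ι]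
    (u : OrthonormalBasis ι ℝ F) (μ : ι → ℝ) (hu : ∀ i, T (adjoint T (u i)) = μ i • u i) :
    ∑ i, μ i ^ (p / 2) ≤ ∑ i : Fin d, T.singularValues i ^ p := by
  classical
  have hin : ∀ i j, ⟪adjoint T (u i), adjoint T (u j)⟫ = if i = j then μ j else 0 := by
    intro i j
    rw [adjoint_inner_left, hu, real_inner_smul_right,
      orthonormal_iff_ite.1 u.orthonormal]
    simp
  have hμ : ∀ i, 0 ≤ μ i := fun i => by
    have := hin i i
    rw [if_pos rfl] at this
    exact this ▸ real_inner_self_nonneg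
  have key := T.sum_abs_inner_rpow_le_sum_singularValues hd hp
    (x := fun i : {i // μ i ≠ 0} => u i)
    (y := fun i : {i // μ i ≠ 0} => (√(μ i))⁻¹ • adjoint T (u i))
    (u.orthonormal.comp _ Subtype.val_injective) (by
      rw [orthonormal_iff_ite]
      rintro ⟨i, hi⟩ ⟨j, hj⟩
      simp only [real_inner_smul_left, real_inner_smul_right, hin, Subtype.mk.injEq]
      split_ifs with h
      · subst h
        have : √(μ i) ≠ 0 := by rw [Real.sqrt_ne_zero (hμ i)]; exact hi
        field_simp
        exact (Real.sq_sqrt (hμ i)).symm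
      · simp)
  refine le_trans (le_of_eq ?_) key
  have h2 : ∀ i : {i // μ i ≠ 0}, |⟪u i, T ((√(μ i))⁻¹ • adjoint T (u i))⟫| ^ p =
      μ i ^ (p / 2) := by
    rintro ⟨i, hi⟩
    have : √(μ i) ≠ 0 := by rw [Real.sqrt_ne_zero (hμ i)]; exact hi
    have h3 : (√(μ i))⁻¹ * μ i = √(μ i) := by
      nth_rw 2 [← Real.mul_self_sqrt (hμ i)]
      field_simp
    simp only [map_smul, hu, real_inner_smul_right, real_inner_self_eq_norm_sq, u.orthonormal.1 i,
      one_pow, mul_one]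
    rw [h3, abs_of_nonneg (Real.sqrt_nonneg _), Real.sqrt_eq_rpow, ← Real.rpow_mul (hμ i)]
    congr 1; ring
  simp only [h2]
  refine (Fintype.sum_subtype_of_eq_zero _ (fun i => μ i ^ (p / 2)) fun i hi => ?_).symm
  rw [not_not.1 hi, Real.zero_rpow (by linarith)]

theorem sq_singularValues_zero_le (T : E →ₗ[ℝ] F) {ι : Type*} [Fintype ι]
    (u : OrthonormalBasis ι ℝ F) (μ : ι → ℝ) (hu : ∀ i, T (adjoint T (u i)) = μ i • u i)
    {Λ : ℝ} (hΛ : ∀ i, μ i ≤ Λ) (hΛ0 : 0 ≤ Λ) : T.singularValues 0 ^ 2 ≤ Λ := by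
  by_cases h0 : T.singularValues 0 = 0
  · rwa [h0, zero_pow two_ne_zero]
  have hpos : 0 < Module.finrank ℝ E := by
    by_contra h
    exact h0 (T.singularValues_of_finrank_le (by omega))
  set b := T.rightSingularBasis rfl ⟨0, hpos⟩ with hb
  have h1 : adjoint T (T b) = T.singularValues 0 ^ 2 • b :=
    T.adjoint_apply_rightSingularBasis rfl ⟨0, hpos⟩
  have h2 : ‖T b‖ = T.singularValues 0 := T.norm_apply_rightSingularBasis rfl ⟨0, hpos⟩
  have h3 : ‖adjoint T (T b)‖ ^ 2 ≤ Λ * ‖T b‖ ^ 2 := by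
    rw [← real_inner_self_eq_norm_sq, adjoint_inner_left, ← u.sum_sq_inner_right (T b),
      Finset.mul_sum]
    have : T (adjoint T (T b)) = ∑ i, ⟪u i, T b⟫ • μ i • u i := by
      conv_lhs => rw [← u.sum_repr' (T b)]
      simp [map_sum, hu]
    rw [this, inner_sum]
    refine Finset.sum_le_sum fun i _ => ?_
    rw [real_inner_smul_right, real_inner_smul_right, real_inner_comm]
    nlinarith [hΛ i, sq_nonneg ⟪u i, T b⟫]
  rw [h1, norm_smul, h2, (T.rightSingularBasis rfl).orthonormal.1, mul_one, norm_pow,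
    Real.norm_eq_abs, sq_abs, sq (T.singularValues 0 ^ 2)] at h3
  exact le_of_mul_le_mul_right h3 (by positivity)

end LinearMap

/-! ### Query count and variational property of Krylov iteration -/

section

open Matrix

namespace MatVecProgram

variable {n d : ℕ} {α β : Type} (A : Matrix (Fin n) (Fin d) ℝ)

theorem run_bind (P : MatVecProgram n d α) (f : α → MatVecProgram n d β) :
    (P.bind f).run A = (f (P.run A)).run A := by
  induction P with
  | done a => rfl
  | mul x next ih => exact ih _
  | mulTranspose y next ih => exact ih _

theorem queries_bind (P : MatVecProgram n d α) (f : α → MatVecProgram n d β) :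
    (P.bind f).queries A = P.queries A + (f (P.run A)).queries A := by
  induction P with
  | done a => simp [bind, queries, run]
  | mul x next ih => simp only [bind, queries, run, ih]; omega
  | mulTranspose y next ih => simp only [bind, queries, run, ih]; omega

end MatVecProgram

section Krylov

open MatVecProgram

variable {n d : ℕ} (A : Matrix (Fin n) (Fin d) ℝ)

theorem run_krylovColumns (g : Fin n → ℝ) (t : ℕ) :
    (krylovColumns g t).run A = fun i : Fin (t + 1) => ((A * Aᵀ) ^ (i : ℕ)) *ᵥ g := by
  induction t with
  | zero => funext i; simp [krylovColumns, run]
  | succ t ih =>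
    rw [krylovColumns, run_bind, ih]
    funext i
    refine Fin.lastCases ?_ (fun i => ?_) i
    · simp [run, pow_succ', Matrix.mulVec_mulVec, Matrix.mul_assoc]
    · simp [run]

theorem queries_krylovColumns (g : Fin n → ℝ) (t : ℕ) :
    (krylovColumns g t).queries A = 2 * t := by
  induction t with
  | zero => rfl
  | succ t ih =>
    rw [krylovColumns, queries_bind, ih]
    simp [queries]
    omega

theorem run_transposeColumns (r : ℕ) (q : Fin r → Fin n → ℝ) :
    (transposeColumns r q).run A = fun i => Aᵀ *ᵥ q i := by
  induction r with
  | zero => funext i; exact i.elim0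
  | succ r ih =>
    rw [transposeColumns, run, run_bind, ih]
    funext i
    refine Fin.cases ?_ (fun i => ?_) i <;> simp [run]

theorem queries_transposeColumns (r : ℕ) (q : Fin r → Fin n → ℝ) :
    (transposeColumns r q).queries A = r := by
  induction r with
  | zero => rfl
  | succ r ih =>
    rw [transposeColumns, queries, queries_bind, ih]
    simp [queries]

theorem euclNorm_sq {m : ℕ} (x : Fin m → ℝ) : euclNorm x ^ 2 = x ⬝ᵥ x := by
  rw [euclNorm, EuclideanSpace.real_norm_sq_eq]
  simp [dotProduct, sq]

theorem euclNorm_normalizeVec [NeZero d] (x : Fin d → ℝ) : euclNorm (normalizeVec x) = 1 := by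
  classical
  rw [normalizeVec]
  split_ifs with h
  · have h1 := euclNorm_sq (Pi.single (0 : Fin d) (1 : ℝ))
    simp only [single_one_dotProduct, Pi.single_eq_same] at h1
    exact (pow_eq_one_iff_of_nonneg (norm_nonneg _) two_ne_zero).1 h1
  · have : ‖WithLp.toLp 2 x‖ ≠ 0 := by simpa using h
    rw [euclNorm, euclNorm, WithLp.toLp_smul, norm_smul, norm_inv, norm_norm,
      inv_mul_cancel₀ this]

theorem rank_le_of_orthonormal_of_span_eq {r m : ℕ} {Q : Matrix (Fin n) (Fin r) ℝ}
    {K : Matrix (Fin n) (Fin m) ℝ} (hQ : Qᵀ * Q = 1)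
    (hs : Submodule.span ℝ (Set.range Q.col) = Submodule.span ℝ (Set.range K.col)) : r ≤ m := by
  have h1 : Q.rank = r := by
    rw [← Matrix.rank_transpose_mul_self, hQ, Matrix.rank_one, Fintype.card_fin]
  rw [← h1, Matrix.rank_eq_finrank_span_cols, hs, ← Matrix.rank_eq_finrank_span_cols]
  exact K.rank_le_width

/-- `2 * t` products build the Krylov matrix, and its column span has dimension at most `t + 1`,
which bounds the products with `Q`. -/
theorem queries_krylovIteration_le [NeZero d] (S : LinAlgSubroutines n) (t : ℕ) (g : Fin n → ℝ) :
    (krylovIteration S t g).queries A ≤ 3 * t + 1 := by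
  have := rank_le_of_orthonormal_of_span_eq
    (S.basis_orthonormal (Matrix.of ((krylovColumns g t).run A))ᵀ) (S.basis_span _)
  simp only [krylovIteration, queries_bind, queries_krylovColumns, queries_transposeColumns,
    queries]
  omega

theorem euclNorm_run_krylovIteration [NeZero d] (S : LinAlgSubroutines n) (t : ℕ)
    (g : Fin n → ℝ) : euclNorm ((krylovIteration S t g).run A) = 1 := by
  simp only [krylovIteration, run_bind, run]
  exact euclNorm_normalizeVec _

theorem dotProduct_mulVec_le_of_isGreatest_spectrum {r : ℕ} {M : Matrix (Fin r) (Fin r) ℝ}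
    (hM : M.IsSymm) {μ : ℝ} (hμ : IsGreatest (spectrum ℝ M) μ) (c : Fin r → ℝ) :
    c ⬝ᵥ M *ᵥ c ≤ μ * (c ⬝ᵥ c) := by
  have h : (algebraMap ℝ _ μ - M).PosSemidef := by
    rw [posSemidef_iff_isHermitian_and_spectrum_nonneg]
    refine ⟨?_, ?_⟩
    · rw [Matrix.IsHermitian, conjTranspose_eq_transpose_of_trivial, Algebra.algebraMap_eq_smul_one,
        transpose_sub, transpose_smul, transpose_one, hM.eq]
    · rw [← spectrum.singleton_sub_eq]
      rintro x ⟨_, rfl, y, hy, rfl⟩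
      exact sub_nonneg.2 (hμ.2 hy)
  have h1 := h.dotProduct_mulVec_nonneg c
  rw [Algebra.algebraMap_eq_smul_one, sub_mulVec, smul_mulVec, one_mulVec, dotProduct_sub,
    dotProduct_smul, star_trivial, smul_eq_mul] at h1
  linarith

/-- Krylov iteration normalizes `Aᵀ q`, where `q` is a unit vector that maximizes the Rayleigh
quotient of `AAᵀ` over the Krylov space. -/
theorem exists_run_krylovIteration_eq_normalizeVec [NeZero d] (S : LinAlgSubroutines n) (t : ℕ)
    {g : Fin n → ℝ} (hg : g ≠ 0) :
    ∃ q : Fin n → ℝ, q ⬝ᵥ q = 1 ∧ (krylovIteration S t g).run A = normalizeVec (Aᵀ *ᵥ q) ∧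
      ∀ z ∈ Submodule.span ℝ (Set.range fun i : Fin (t + 1) => ((A * Aᵀ) ^ (i : ℕ)) *ᵥ g),
        (Aᵀ *ᵥ z) ⬝ᵥ (Aᵀ *ᵥ z) ≤ (Aᵀ *ᵥ q) ⬝ᵥ (Aᵀ *ᵥ q) * (z ⬝ᵥ z) := by
  simp only [krylovIteration, run_bind, run_transposeColumns, run]
  set K : Matrix (Fin n) (Fin (t + 1)) ℝ :=
    (Matrix.of ((krylovColumns g t).run A))ᵀ with hK
  have hQ := S.basis_orthonormal K
  have hs := S.basis_span K
  set r := (S.basis K).1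
  set Q : Matrix (Fin n) (Fin r) ℝ := (S.basis K).2
  have hW : (Matrix.of fun i => Aᵀ *ᵥ Q.col i)ᵀ = Aᵀ * Q := by
    ext i j
    simp [Matrix.mul_apply, mulVec, dotProduct, Matrix.col]
  rw [hW]
  set W := Aᵀ * Q with hWd
  have hKs : Submodule.span ℝ (Set.range fun i : Fin (t + 1) => ((A * Aᵀ) ^ (i : ℕ)) *ᵥ g) =
      Submodule.span ℝ (Set.range K.col) := by
    rw [← run_krylovColumns]; rfl
  have hmem : ∀ z ∈ Submodule.span ℝ (Set.range K.col), ∃ c : Fin r → ℝ, Q *ᵥ c = z := by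
    intro z hz
    rw [← hs, ← Matrix.range_mulVecLin] at hz
    exact hz
  -- The Krylov space contains `g ≠ 0`, so the eigenvector specification, which requires positive
  -- size, applies.
  have hr : 0 < r := by
    rw [Nat.pos_iff_ne_zero]
    intro h0
    obtain ⟨c, hc⟩ := hmem g (hKs ▸ Submodule.subset_span ⟨0, by simp⟩)
    apply hg
    rw [← hc]
    funext i
    rw [Pi.zero_apply, mulVec, dotProduct]
    refine Finset.sum_eq_zero fun j _ => ?_
    have := j.2
    omega
  have hM : (Wᵀ * W).IsSymm := by rw [IsSymm, transpose_mul, transpose_transpose]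
  obtain ⟨hy, μ, hμ, hyμ⟩ := S.topEigenvector_spec (Wᵀ * W) hr hM
  set y := S.topEigenvector (Wᵀ * W)
  have hy1 : y ⬝ᵥ y = 1 := by rw [← euclNorm_sq, hy, one_pow]
  have hQQ : ∀ c : Fin r → ℝ, (Q *ᵥ c) ⬝ᵥ (Q *ᵥ c) = c ⬝ᵥ c := fun c => by
    rw [dotProduct_mulVec, ← mulVec_transpose, mulVec_mulVec, hQ, one_mulVec]
  have hWW : ∀ c : Fin r → ℝ, (Aᵀ *ᵥ (Q *ᵥ c)) ⬝ᵥ (Aᵀ *ᵥ (Q *ᵥ c)) = c ⬝ᵥ (Wᵀ * W) *ᵥ c := by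
    intro c
    rw [mulVec_mulVec, ← hWd, dotProduct_mulVec, ← mulVec_transpose, mulVec_mulVec,
      dotProduct_comm]
  refine ⟨Q *ᵥ y, by rw [hQQ, hy1], by rw [mulVec_mulVec], fun z hz => ?_⟩
  obtain ⟨c, rfl⟩ := hmem z (hKs ▸ hz)
  rw [hQQ, hWW, hWW, hyμ, dotProduct_smul, hy1, smul_eq_mul, mul_one]
  exact dotProduct_mulVec_le_of_isGreatest_spectrum hM hμ c

end Krylov

end

/-! ### The Gaussian starting vector -/

section

open MeasureTheory ProbabilityTheory
open scoped RealInnerProductSpace ENNReal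

theorem gaussianReal_sq_lt_le {c : ℝ} (hc : 0 ≤ c) :
    gaussianReal 0 1 {x | x ^ 2 < c ^ 2} ≤ ENNReal.ofReal c := by
  have hset : {x : ℝ | x ^ 2 < c ^ 2} = Set.Ioo (-c) c := by
    ext x
    simp only [Set.mem_ofPred_eq, Set.mem_Ioo, ← abs_lt]
    exact sq_lt_sq.trans (by rw [abs_of_nonneg hc])
  -- A density at most `1/2` on an interval of length `2 * c` gives mass at most `c`.
  have hpdf : ∀ x, gaussianPDF 0 1 x ≤ ENNReal.ofReal (1 / 2) := fun x => by
    refine ENNReal.ofReal_le_ofReal ?_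
    rw [gaussianPDFReal_def]
    have h1 : (2 : ℝ) ≤ √(2 * Real.pi * (1 : NNReal)) := by
      refine Real.le_sqrt_of_sq_le ?_
      have := Real.pi_gt_three
      norm_num; linarith
    have h2 : Real.exp (-(x - 0) ^ 2 / (2 * (1 : NNReal))) ≤ 1 := by
      rw [Real.exp_le_one_iff]
      have := sq_nonneg (x - 0)
      simp only [NNReal.coe_one]
      linarith
    calc _ ≤ (2 : ℝ)⁻¹ * 1 := by
          refine mul_le_mul ?_ h2 (Real.exp_nonneg _) (by norm_num)
          exact inv_anti₀ (by norm_num) h1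
      _ = 1 / 2 := by norm_num
  rw [gaussianReal_apply 0 one_ne_zero, hset]
  calc ∫⁻ x in Set.Ioo (-c) c, gaussianPDF 0 1 x
      ≤ ∫⁻ _ in Set.Ioo (-c) c, ENNReal.ofReal (1 / 2) := lintegral_mono fun x => hpdf x
    _ = ENNReal.ofReal c := by
      rw [setLIntegral_const, Real.volume_Ioo, ← ENNReal.ofReal_mul (by norm_num)]
      congr 1; ring

section

variable {E : Type*} [NormedAddCommGroup E] [InnerProductSpace ℝ E] [FiniteDimensional ℝ E]
  [MeasurableSpace E] [BorelSpace E]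

theorem stdGaussian_map_inner {u : E} (hu : ‖u‖ = 1) :
    (stdGaussian E).map (fun g => ⟪u, g⟫) = gaussianReal 0 1 := by
  have h := IsGaussian.map_eq_gaussianReal (μ := stdGaussian E) (innerSL ℝ u)
  rw [integral_strongDual_stdGaussian, variance_dual_stdGaussian, innerSL_apply_norm, hu] at h
  simpa using h

theorem lintegral_sq_inner_stdGaussian {u : E} (hu : ‖u‖ = 1) :
    ∫⁻ g, ENNReal.ofReal (⟪u, g⟫ ^ 2) ∂(stdGaussian E) = 1 := by
  have hm : Measurable fun g : E => ⟪u, g⟫ := by fun_prop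
  have h1 : ∫⁻ g, ENNReal.ofReal (⟪u, g⟫ ^ 2) ∂(stdGaussian E) =
      ∫⁻ x, ENNReal.ofReal (x ^ 2) ∂(gaussianReal 0 1) := by
    rw [← stdGaussian_map_inner hu, lintegral_map (by fun_prop) hm]
  have h2 : MemLp id 2 (gaussianReal 0 1) := IsGaussian.memLp_two_id
  have h3 := variance_id_gaussianReal (μ := 0) (v := 1)
  rw [variance_of_integral_eq_zero aemeasurable_id (by simp)] at h3
  have h4 := ofReal_integral_eq_lintegral_ofReal h2.integrable_sq
    (Filter.Eventually.of_forall fun x => sq_nonneg x)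
  rw [h3] at h4
  rw [h1]
  simpa using h4.symm

/-- With high probability a standard Gaussian vector has a component along `u i₀` that is not too
small, and weighted squared components along the other vectors of the family that are not too
large. -/
theorem exists_measurableSet_stdGaussian {ι : Type*} [Fintype ι] (u : ι → E)
    (hu : ∀ i, ‖u i‖ = 1) (i₀ : ι) (s : Finset ι) (c : ι → ℝ) (hc : ∀ i, 0 ≤ c i) :
    ∃ G : Set E, MeasurableSet G ∧ 99 / 100 ≤ stdGaussian E G ∧
      ∀ g ∈ G, 1 / 40000 ≤ ⟪u i₀, g⟫ ^ 2 ∧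
        ∑ i ∈ s, c i * ⟪u i, g⟫ ^ 2 ≤ 200 * ∑ i ∈ s, c i := by
  set S := ∑ i ∈ s, c i with hS
  have hS0 : 0 ≤ S := Finset.sum_nonneg fun i _ => hc i
  set N₁ : Set E := {g | ⟪u i₀, g⟫ ^ 2 < (1 / 200 : ℝ) ^ 2} with hN₁
  set N₂ : Set E := {g | 200 * S < ∑ i ∈ s, c i * ⟪u i, g⟫ ^ 2} with hN₂
  have hm₁ : MeasurableSet N₁ := measurableSet_lt (by fun_prop) (by fun_prop)
  have hm₂ : MeasurableSet N₂ := measurableSet_lt (by fun_prop) (by fun_prop)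
  have h₁ : stdGaussian E N₁ ≤ ENNReal.ofReal (1 / 200) := by
    have hm : Measurable fun g : E => ⟪u i₀, g⟫ := by fun_prop
    have := gaussianReal_sq_lt_le (c := 1 / 200) (by norm_num)
    rwa [← stdGaussian_map_inner (hu i₀), Measure.map_apply hm
      (measurableSet_lt (by fun_prop) (by fun_prop))] at this
  have h₂ : stdGaussian E N₂ ≤ ENNReal.ofReal (1 / 200) := by
    -- Markov's inequality needs a positive threshold; for `S = 0` the bad event is empty.
    rcases hS0.eq_or_lt with h0 | h0
    · have hz : N₂ = ∅ := by
        rw [Set.eq_empty_iff_forall_notMem]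
        intro g hg
        rw [hN₂, Set.mem_ofPred_eq, ← h0, mul_zero] at hg
        refine hg.ne' (Finset.sum_eq_zero fun i hi => ?_)
        rw [(Finset.sum_eq_zero_iff_of_nonneg fun i _ => hc i).1 h0.symm i hi, zero_mul]
      rw [hz, measure_empty]
      exact zero_le
    · have hint : ∫⁻ g, ENNReal.ofReal (∑ i ∈ s, c i * ⟪u i, g⟫ ^ 2) ∂(stdGaussian E) =
          ENNReal.ofReal S := by
        simp_rw [ENNReal.ofReal_sum_of_nonneg fun i _ =>
          mul_nonneg (hc i) (sq_nonneg ⟪u i, _⟫), ENNReal.ofReal_mul (hc _)]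
        rw [lintegral_finsetSum _ fun i _ => by fun_prop, hS,
          ENNReal.ofReal_sum_of_nonneg fun i _ => hc i]
        refine Finset.sum_congr rfl fun i _ => ?_
        rw [lintegral_const_mul _ (by fun_prop), lintegral_sq_inner_stdGaussian (hu i), mul_one]
      have hmk := meas_ge_le_lintegral_div (μ := stdGaussian E)
        (f := fun g => ENNReal.ofReal (∑ i ∈ s, c i * ⟪u i, g⟫ ^ 2)) (by fun_prop)
        (ε := ENNReal.ofReal (200 * S)) (by simpa using h0) ENNReal.ofReal_ne_top
      rw [hint, ← ENNReal.ofReal_div_of_pos (by positivity)] at hmk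
      have hdiv : S / (200 * S) = 1 / 200 := by field_simp
      rw [hdiv] at hmk
      refine (measure_mono fun g hg => ?_).trans hmk
      exact ENNReal.ofReal_le_ofReal (le_of_lt hg)
  refine ⟨(N₁ ∪ N₂)ᶜ, (hm₁.union hm₂).compl, ?_, fun g hg => ?_⟩
  · have hun : stdGaussian E (N₁ ∪ N₂) ≤ ENNReal.ofReal (1 / 100) := by
      refine (measure_union_le _ _).trans ((add_le_add h₁ h₂).trans (le_of_eq ?_))
      rw [← ENNReal.ofReal_add (by norm_num) (by norm_num)]
      norm_num
    rw [prob_compl_eq_one_sub (hm₁.union hm₂)]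
    refine le_trans ?_ (tsub_le_tsub_left hun 1)
    rw [← ENNReal.ofReal_one, ← ENNReal.ofReal_sub _ (by norm_num)]
    rw [show (99 / 100 : ℝ≥0∞) = ENNReal.ofReal (99 / 100) by
      rw [ENNReal.ofReal_div_of_pos (by norm_num)]; norm_num]
    exact ENNReal.ofReal_le_ofReal (by norm_num)
  · simp only [Set.mem_compl_iff, Set.mem_union, not_or, hN₁, hN₂, Set.mem_ofPred_eq, not_lt] at hg
    exact ⟨by norm_num at hg ⊢; exact hg.1, hg.2⟩

end

end

/-! ### From the Rayleigh quotient to the Schatten norm -/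

section

open scoped RealInnerProductSpace

/-- Bernoulli for `p ≥ 2`. For smaller `p` and `x ≤ 1`, lowering the exponent below `1` only
increases the power. -/
theorem one_sub_mul_le_rpow {p x δ : ℝ} (hp : 1 ≤ p) (hx : 0 ≤ x) (hδ : 0 ≤ δ) (h : 1 - δ ≤ x) :
    1 - p * δ ≤ x ^ (p / 2) := by
  rcases le_total 2 p with h2 | h2
  · have := one_add_mul_self_le_rpow_one_add (s := x - 1) (by linarith) (p := p / 2) (by linarith)
    rw [add_sub_cancel] at this
    refine le_trans ?_ this
    nlinarith
  · rcases le_total 1 x with h1 | h1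
    · have := Real.one_le_rpow h1 (show 0 ≤ p / 2 by linarith)
      nlinarith
    · have h3 : x ≤ x ^ (p / 2) := by
        nth_rw 1 [← Real.rpow_one x]
        exact Real.rpow_le_rpow_of_exponent_ge' hx h1 (by linarith) (by linarith)
      nlinarith

open Polynomial in
theorem inner_aeval_apply_of_eigenbasis {F : Type*} [NormedAddCommGroup F]
    [InnerProductSpace ℝ F] {ι : Type*} [Fintype ι] {P : F →ₗ[ℝ] F}
    {u : OrthonormalBasis ι ℝ F} {μ : ι → ℝ} (hu : ∀ i, P (u i) = μ i • u i) (f : ℝ[X]) (g : F)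
    (i : ι) : ⟪u i, aeval P f g⟫ = f.eval (μ i) * ⟪u i, g⟫ := by
  classical
  conv_lhs => rw [← u.sum_repr' g, map_sum, inner_sum]
  rw [Finset.sum_eq_single i]
  · rw [map_smul, Module.End.aeval_apply_of_mem_apply_eq_smul (hu i),
      real_inner_smul_right, real_inner_smul_right, real_inner_self_eq_norm_sq, u.orthonormal.1 i]
    ring
  · intro j _ hj
    rw [map_smul, Module.End.aeval_apply_of_mem_apply_eq_smul (hu j),
      real_inner_smul_right, real_inner_smul_right, u.orthonormal.2 hj.symm, mul_zero, mul_zero]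
  · simp

section

variable {E F : Type*} [NormedAddCommGroup E] [InnerProductSpace ℝ E] [FiniteDimensional ℝ E]
  [NormedAddCommGroup F] [InnerProductSpace ℝ F] [FiniteDimensional ℝ F]

open Polynomial LinearMap in
/-- A unit vector whose Rayleigh quotient beats those of all polynomials of degree
`krylovDegree p ε` applied to a good starting vector is close to optimal. -/
theorem rpow_sub_le_norm_adjoint_rpow {p ε : ℝ} (hp : 1 ≤ p) (hε0 : 0 < ε) (hε1 : ε < 1)
    (T : E →ₗ[ℝ] F) {ι : Type*} [Fintype ι] [DecidableEq ι] (u : OrthonormalBasis ι ℝ F)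
    (μ : ι → ℝ) (hu : ∀ i, T (adjoint T (u i)) = μ i • u i) (i₀ : ι) (hmax : ∀ i, μ i ≤ μ i₀)
    (hpos : 0 < μ i₀) {g q : F} (hg₀ : 1 / 40000 ≤ ⟪u i₀, g⟫ ^ 2)
    (hg : ∑ i ∈ Finset.univ.erase i₀, (μ i / μ i₀) ^ (p / 2) * ⟪u i, g⟫ ^ 2 ≤
      200 * ∑ i ∈ Finset.univ.erase i₀, (μ i / μ i₀) ^ (p / 2))
    (hq : ∀ f : ℝ[X], f.natDegree ≤ krylovDegree p ε →
      ‖adjoint T (aeval (T ∘ₗ adjoint T) f g)‖ ^ 2 ≤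
        ‖adjoint T q‖ ^ 2 * ‖aeval (T ∘ₗ adjoint T) f g‖ ^ 2) :
    0 < ‖adjoint T q‖ ∧
      μ i₀ ^ (p / 2) - ε * (∑ i, μ i ^ (p / 2) - μ i₀ ^ (p / 2)) ≤ ‖adjoint T q‖ ^ p := by
  set Λ := μ i₀ with hΛ
  set P := T ∘ₗ adjoint T with hP
  have hμ : ∀ i, 0 ≤ μ i := fun i => by
    have : ⟪adjoint T (u i), adjoint T (u i)⟫ = μ i := by
      rw [adjoint_inner_left, hu, real_inner_smul_right, real_inner_self_eq_norm_sq,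
        u.orthonormal.1 i]
      ring
    exact this ▸ real_inner_self_nonneg
  obtain ⟨f, hfd, hf1, hf⟩ := exists_polynomial_weighted_residual_le hp hε0 hε1 i₀
    (fun i => μ i / Λ) (fun i => ⟪u i, g⟫ ^ 2) (fun i => div_nonneg (hμ i) hpos.le)
    (fun i => (div_le_one hpos).2 (hmax i)) (div_self hpos.ne') (fun i => sq_nonneg _) hg₀ hg
  set S := ∑ i ∈ Finset.univ.erase i₀, (μ i / Λ) ^ (p / 2) with hS
  have hS0 : 0 ≤ S := Finset.sum_nonneg fun i _ =>
    Real.rpow_nonneg (div_nonneg (hμ i) hpos.le) _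
  set w : ι → ℝ := fun i => f.eval (μ i / Λ) ^ 2 * ⟪u i, g⟫ ^ 2 with hw
  have hw0 : ∀ i, 0 ≤ w i := fun i => by positivity
  have hwi : 0 < w i₀ := by
    simp only [hw]
    rw [div_self hpos.ne', hf1]
    linarith
  -- Rescaling the variable by `Λ⁻¹` turns a filter on the unit interval into one on the spectrum,
  -- with the same degree bound.
  set z := aeval P (f.comp (C Λ⁻¹ * X)) g with hz
  have hzi : ∀ i, ⟪u i, z⟫ = f.eval (μ i / Λ) * ⟪u i, g⟫ := fun i => by
    rw [hz, inner_aeval_apply_of_eigenbasis (μ := μ) (fun i => hu i)]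
    simp [eval_comp, div_eq_inv_mul]
  have hz1 : ‖z‖ ^ 2 = ∑ i, w i := by
    rw [← u.sum_sq_inner_right z]
    exact Finset.sum_congr rfl fun i _ => by rw [hzi, mul_pow]
  have hz2 : ‖adjoint T z‖ ^ 2 = ∑ i, μ i * w i := by
    rw [← real_inner_self_eq_norm_sq, adjoint_inner_left]
    have : T (adjoint T z) = ∑ i, ⟪u i, z⟫ • μ i • u i := by
      conv_lhs => rw [← u.sum_repr' z]
      simp [map_sum, hu]
    rw [this, inner_sum]
    refine Finset.sum_congr rfl fun i _ => ?_
    rw [real_inner_smul_right, real_inner_smul_right, real_inner_comm (u i), hzi]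
    simp only [hw]; ring
  have hray := hq (f.comp (C Λ⁻¹ * X)) (natDegree_comp_le.trans (by
    calc _ ≤ krylovDegree p ε * 1 := by
          gcongr
          exact (natDegree_C_mul_le _ _).trans natDegree_X_le
      _ = _ := mul_one _))
  rw [← hz, hz1, hz2] at hray
  set ρ := ‖adjoint T q‖ ^ 2 with hρ
  have hW : 0 < ∑ i, w i := Finset.sum_pos' (fun i _ => hw0 i) ⟨i₀, Finset.mem_univ _, hwi⟩
  have hρ0 : 0 < ρ := by
    have h1 : Λ * w i₀ ≤ ∑ i, μ i * w i := Finset.single_le_sum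
      (f := fun i => μ i * w i) (fun i _ => mul_nonneg (hμ i) (hw0 i)) (Finset.mem_univ i₀)
    have h2 : 0 < Λ * w i₀ := by positivity
    exact pos_of_mul_pos_left (h2.trans_le (h1.trans hray)) hW.le
  have hc0 : 0 < ‖adjoint T q‖ := by
    by_contra h
    rw [hρ, le_antisymm (not_lt.1 h) (norm_nonneg _)] at hρ0
    norm_num at hρ0
  refine ⟨hc0, ?_⟩
  -- The Rayleigh quotient of `z` is the average of the `μ i` with weights `w i`; the filter bounds
  -- the average of `1 - μ i / Λ`.
  have hle : 1 - ε / p * S ≤ ρ / Λ := by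
    have h1 : ∑ i, (1 - μ i / Λ) * w i = ∑ i, w i - (∑ i, μ i * w i) / Λ := by
      rw [Finset.sum_div, ← Finset.sum_sub_distrib]
      exact Finset.sum_congr rfl fun i _ => by ring
    have h2 : ∑ i, w i - (∑ i, μ i * w i) / Λ ≤ ε / p * S * ∑ i, w i := h1 ▸ hf
    have h3 : (∑ i, μ i * w i) / Λ ≤ ρ / Λ * ∑ i, w i := by
      rw [div_mul_eq_mul_div]; gcongr
    refine le_of_mul_le_mul_right ?_ hW
    linarith
  have hpow := one_sub_mul_le_rpow hp (by positivity) (by positivity) hle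
  have hpS : p * (ε / p * S) = ε * S := by field_simp
  have hρp : ρ ^ (p / 2) = ‖adjoint T q‖ ^ p := by
    rw [hρ, ← Real.rpow_natCast, ← Real.rpow_mul (norm_nonneg _)]
    congr 1; push_cast; ring
  have hΛp : 0 < Λ ^ (p / 2) := Real.rpow_pos_of_pos hpos _
  have hSΛ : Λ ^ (p / 2) * S = ∑ i, μ i ^ (p / 2) - Λ ^ (p / 2) := by
    rw [← Finset.add_sum_erase _ _ (Finset.mem_univ i₀), hS, Finset.mul_sum, add_sub_cancel_left]
    refine Finset.sum_congr rfl fun i _ => ?_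
    rw [Real.div_rpow (hμ i) hpos.le, mul_div_cancel₀ _ hΛp.ne']
  rw [hpS, Real.div_rpow hρ0.le hpos.le, le_div_iff₀ hΛp, hρp] at hpow
  rw [← hSΛ]
  linarith

end

section

open Matrix

variable {n d : ℕ}

theorem schattenNorm_nonneg (p : ℝ) (M : Matrix (Fin n) (Fin d) ℝ) : 0 ≤ schattenNorm p M :=
  Real.rpow_nonneg (Finset.sum_nonneg fun _ _ =>
    Real.rpow_nonneg (LinearMap.singularValues_nonneg _ _) _) _

theorem schattenNorm_rpow {p : ℝ} (hp : p ≠ 0) (M : Matrix (Fin n) (Fin d) ℝ) :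
    schattenNorm p M ^ p = ∑ i : Fin d, (toEuclideanLin M).singularValues (i : ℕ) ^ p := by
  rw [schattenNorm, ← Real.rpow_mul (Finset.sum_nonneg fun _ _ =>
    Real.rpow_nonneg (LinearMap.singularValues_nonneg _ _) _), one_div_mul_cancel hp,
    Real.rpow_one]

theorem ofLp_toEuclideanLin_eq_mulVec (M : Matrix (Fin n) (Fin d) ℝ)
    (x : EuclideanSpace ℝ (Fin d)) : (toEuclideanLin M x).ofLp = M *ᵥ x.ofLp :=
  rfl

theorem toEuclideanLin_rankOneResidual_apply (A : Matrix (Fin n) (Fin d) ℝ) (u : Fin d → ℝ)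
    (x : EuclideanSpace ℝ (Fin d)) : toEuclideanLin (rankOneResidual A u) x =
      toEuclideanLin A (x - ⟪WithLp.toLp 2 u, x⟫ • WithLp.toLp 2 u) := by
  apply WithLp.ofLp_injective
  rw [ofLp_toEuclideanLin_eq_mulVec, ofLp_toEuclideanLin_eq_mulVec, rankOneResidual,
    ← mulVec_mulVec,
    sub_mulVec, one_mulVec, vecMulVec_mulVec]
  congr 1
  ext i
  simp [PiLp.inner_apply, dotProduct, mul_comm]

theorem adjoint_toEuclideanLin (A : Matrix (Fin n) (Fin d) ℝ) :
    LinearMap.adjoint (toEuclideanLin A) = toEuclideanLin Aᵀ := by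
  rw [← toEuclideanLin_conjTranspose_eq_adjoint, conjTranspose_eq_transpose_of_trivial]

theorem norm_sq_eq_dotProduct {m : ℕ} (x : EuclideanSpace ℝ (Fin m)) :
    ‖x‖ ^ 2 = x.ofLp ⬝ᵥ x.ofLp := euclNorm_sq x.ofLp

open Polynomial in
theorem ofLp_aeval_mem_span (A : Matrix (Fin n) (Fin d) ℝ) {t : ℕ} {f : ℝ[X]}
    (hf : f.natDegree ≤ t) (g : EuclideanSpace ℝ (Fin n)) :
    (aeval (toEuclideanLin A ∘ₗ LinearMap.adjoint (toEuclideanLin A)) f g).ofLp ∈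
      Submodule.span ℝ (Set.range fun i : Fin (t + 1) => ((A * Aᵀ) ^ (i : ℕ)) *ᵥ g.ofLp) := by
  have hpow : ∀ k : ℕ, (((toEuclideanLin A ∘ₗ LinearMap.adjoint (toEuclideanLin A)) ^ k) g).ofLp =
      ((A * Aᵀ) ^ k) *ᵥ g.ofLp := by
    intro k
    induction k with
    | zero => simp
    | succ k ih =>
      rw [pow_succ', Module.End.mul_apply, LinearMap.comp_apply, adjoint_toEuclideanLin,
        ofLp_toEuclideanLin_eq_mulVec, ofLp_toEuclideanLin_eq_mulVec, ← adjoint_toEuclideanLin, ih,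
        mulVec_mulVec, mulVec_mulVec, pow_succ', Matrix.mul_assoc]
  rw [aeval_eq_sum_range' (Nat.lt_succ_of_le hf), LinearMap.sum_apply, WithLp.ofLp_sum]
  refine Submodule.sum_mem _ fun k hk => ?_
  rw [LinearMap.smul_apply, WithLp.ofLp_smul, hpow]
  exact Submodule.smul_mem _ _ (Submodule.subset_span ⟨⟨k, Finset.mem_range.1 hk⟩, rfl⟩)

/-- The bound on `p`-th powers is the stronger one, because `1 + ε ≤ (1 + ε) ^ p`. -/
theorem le_one_add_mul_of_rpow_le {p ε x y : ℝ} (hp : 1 ≤ p) (hε : 0 ≤ ε) (hx : 0 ≤ x) (hy : 0 ≤ y)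
    (h : x ^ p ≤ (1 + ε) * y ^ p) : x ≤ (1 + ε) * y := by
  rw [← Real.rpow_le_rpow_iff hx (by positivity) (show 0 < p by linarith),
    Real.mul_rpow (by positivity) hy]
  refine h.trans ?_
  gcongr
  exact Real.self_le_rpow_of_one_le (by linarith) hp

theorem exists_measurableSet_krylovIteration {p ε : ℝ} (hp : 1 ≤ p) (hε0 : 0 < ε) (hε1 : ε < 1)
    [NeZero d] (S : LinAlgSubroutines n) {A : Matrix (Fin n) (Fin d) ℝ} (hA : A ≠ 0) :
    ∃ G : Set (EuclideanSpace ℝ (Fin n)), MeasurableSet G ∧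
      99 / 100 ≤ ProbabilityTheory.stdGaussian (EuclideanSpace ℝ (Fin n)) G ∧
      ∀ g ∈ G, ∀ u : Fin d → ℝ,
        schattenNorm p (rankOneResidual A ((krylovIteration S (krylovDegree p ε) g.ofLp).run A)) ^ p
          ≤ (1 + ε) * schattenNorm p (rankOneResidual A u) ^ p := by
  have hp0 : p ≠ 0 := by linarith
  set T := toEuclideanLin A with hT
  have hT0 : T ≠ 0 := by simpa [hT] using hA
  have hsym : (T ∘ₗ LinearMap.adjoint T).IsSymmetric := T.isSymmetric_self_comp_adjoint
  set b := hsym.eigenvectorBasis finrank_euclideanSpace_fin with hb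
  set μ := hsym.eigenvalues finrank_euclideanSpace_fin with hμ
  have hbμ : ∀ i, T (LinearMap.adjoint T (b i)) = μ i • b i := fun i =>
    hsym.apply_eigenvectorBasis finrank_euclideanSpace_fin i
  have hμ0 : ∀ i, 0 ≤ μ i := T.isPositive_self_comp_adjoint.nonneg_eigenvalues _
  have hne : Nonempty (Fin n) := by
    by_contra h
    rw [not_nonempty_iff] at h
    exact hA (Subsingleton.elim _ _)
  obtain ⟨i₀, hmax⟩ := Finite.exists_max μ
  have hσ : T.singularValues 0 ^ 2 ≤ μ i₀ :=
    T.sq_singularValues_zero_le b μ hbμ hmax (hμ0 i₀)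
  have hσ0 : 0 < T.singularValues 0 := by
    rw [LinearMap.singularValues_pos_iff_lt_finrank_range, Module.finrank_pos_iff,
      Submodule.nontrivial_iff_ne_bot]
    exact fun h => hT0 (LinearMap.range_eq_bot.1 h)
  have hpos : 0 < μ i₀ := lt_of_lt_of_le (by positivity) hσ
  obtain ⟨G, hGm, hG, hGg⟩ := exists_measurableSet_stdGaussian b (fun i => b.orthonormal.1 i) i₀
    (Finset.univ.erase i₀) (fun i => (μ i / μ i₀) ^ (p / 2))
    fun i => Real.rpow_nonneg (div_nonneg (hμ0 i) hpos.le) _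
  refine ⟨G, hGm, hG, fun g hg u => ?_⟩
  obtain ⟨hg₀, hgs⟩ := hGg g hg
  have hg0 : g.ofLp ≠ 0 := by
    intro h
    have : g = 0 := WithLp.ofLp_injective _ h
    rw [this, inner_zero_right] at hg₀
    norm_num at hg₀
  obtain ⟨q, hq1, hrun, hq⟩ :=
    exists_run_krylovIteration_eq_normalizeVec A S (krylovDegree p ε) hg0
  set q' : EuclideanSpace ℝ (Fin n) := WithLp.toLp 2 q with hq'
  have hTq : ∀ z : EuclideanSpace ℝ (Fin n), (LinearMap.adjoint T z).ofLp = Aᵀ *ᵥ z.ofLp :=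
    fun z => by rw [hT, adjoint_toEuclideanLin, ofLp_toEuclideanLin_eq_mulVec]
  obtain ⟨hc, hlow⟩ := rpow_sub_le_norm_adjoint_rpow hp hε0 hε1 T b μ hbμ i₀ hmax hpos
    (g := g) (q := q') hg₀ hgs fun f hf => by
      rw [norm_sq_eq_dotProduct, norm_sq_eq_dotProduct, norm_sq_eq_dotProduct, hTq, hTq]
      exact hq _ (ofLp_aeval_mem_span A hf g)
  set c := ‖LinearMap.adjoint T q'‖ with hcdef
  set v : EuclideanSpace ℝ (Fin d) := c⁻¹ • LinearMap.adjoint T q' with hv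
  have hrun' : (krylovIteration S (krylovDegree p ε) g.ofLp).run A = v.ofLp := by
    have h0 : Aᵀ *ᵥ q ≠ 0 := by
      intro h
      have h1 := norm_sq_eq_dotProduct (LinearMap.adjoint T q')
      rw [hTq, h, dotProduct_zero, ← hcdef] at h1
      exact hc.ne' (pow_eq_zero_iff two_ne_zero |>.1 h1)
    have h2 : euclNorm (Aᵀ *ᵥ q) = c := by
      rw [euclNorm, hcdef]
      congr 1
      exact WithLp.ofLp_injective _ (hTq q').symm
    rw [hrun, normalizeVec, if_neg h0, h2, hv, WithLp.ofLp_smul, hTq]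
  have hdefl := LinearMap.sum_singularValues_rpow_add_le_of_adjoint_eq_smul (T := T)
    (B := toEuclideanLin (rankOneResidual A v.ofLp)) finrank_euclideanSpace_fin hp
    (q := q') (v := v) (c := c) hc.le
    ((pow_eq_one_iff_of_nonneg (norm_nonneg _) two_ne_zero).1
      ((norm_sq_eq_dotProduct q').trans hq1))
    (by rw [hv, norm_smul, norm_inv, hcdef, norm_norm, inv_mul_cancel₀ hc.ne'])
    (by rw [hv, smul_inv_smul₀ hc.ne'])
    (fun x => toEuclideanLin_rankOneResidual_apply A v.ofLp x)
  have hopt := LinearMap.sum_singularValues_rpow_le_of_eq_on_orthogonal (T := T)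
    (T' := toEuclideanLin (rankOneResidual A u)) (u := WithLp.toLp 2 u)
    (fun x hx => by rw [toEuclideanLin_rankOneResidual_apply, hx, zero_smul, sub_zero])
    (show 0 ≤ p by linarith) d
  have hsum := T.sum_eigenvalues_rpow_le_sum_singularValues finrank_euclideanSpace_fin hp b μ hbμ
  have hσp : T.singularValues 0 ^ p ≤ μ i₀ ^ (p / 2) := by
    calc T.singularValues 0 ^ p = (T.singularValues 0 ^ 2) ^ (p / 2) := by
          rw [← Real.rpow_natCast, ← Real.rpow_mul hσ0.le]
          congr 1; push_cast; ring
      _ ≤ _ := by gcongr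
  rw [schattenNorm_rpow hp0, schattenNorm_rpow hp0, hrun']
  -- With `Σ = ∑ σ i ^ p`, the residual is at most `Σ - c ^ p ≤ (1 + ε) * (Σ - μ i₀ ^ (p / 2)) ≤ (1
  -- + ε) * (Σ - σ 0 ^ p)`, and `Σ - σ 0 ^ p` is at most the residual of `u`.
  nlinarith

end

end

theorem theorem1p2 :
    ∃ C : ℝ, 0 < C ∧ ∀ p ε : ℝ, 1 ≤ p → 0 < ε → ε < 1 →
      ∃ t : ℕ, ∀ (n d : ℕ) [NeZero d] (S : LinAlgSubroutines n) (A : Matrix (Fin n) (Fin d) ℝ),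
        (∀ g : Fin n → ℝ,
          ((krylovIteration S t g).queries A : ℝ)
              ≤ C * (p * Real.log (2 / ε) / ε ^ (1 / 3 : ℝ)) ∧
            euclNorm ((krylovIteration S t g).run A) = 1) ∧
        ∃ E : Set (EuclideanSpace ℝ (Fin n)), MeasurableSet E ∧
          99 / 100 ≤ ProbabilityTheory.stdGaussian (EuclideanSpace ℝ (Fin n)) E ∧
          ∀ g ∈ E, ∀ u : Fin d → ℝ, euclNorm u = 1 →
            schattenNorm p (rankOneResidual A ((krylovIteration S t g.ofLp).run A))
                ≤ (1 + ε) * schattenNorm p (rankOneResidual A u) ∧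
            schattenNorm p (rankOneResidual A ((krylovIteration S t g.ofLp).run A)) ^ p
                ≤ (1 + ε) * schattenNorm p (rankOneResidual A u) ^ p := by
  refine ⟨1000, by norm_num, fun p ε hp hε0 hε1 => ⟨krylovDegree p ε, ?_⟩⟩
  intro n d _ S A
  refine ⟨fun g => ⟨?_, euclNorm_run_krylovIteration A S _ g⟩, ?_⟩
  · refine le_trans ?_ (three_mul_krylovDegree_add_one_le hp hε0 hε1)
    exact_mod_cast queries_krylovIteration_le A S (krylovDegree p ε) g
  · obtain ⟨G, hGm, hG, hres⟩ : ∃ G : Set (EuclideanSpace ℝ (Fin n)), MeasurableSet G ∧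
        99 / 100 ≤ ProbabilityTheory.stdGaussian (EuclideanSpace ℝ (Fin n)) G ∧
        ∀ g ∈ G, ∀ u : Fin d → ℝ, schattenNorm p
            (rankOneResidual A ((krylovIteration S (krylovDegree p ε) g.ofLp).run A)) ^ p
          ≤ (1 + ε) * schattenNorm p (rankOneResidual A u) ^ p := by
      -- The zero matrix has no positive top eigenvalue to rescale by, but all its residuals vanish.
      by_cases hA : A = 0
      · refine ⟨Set.univ, MeasurableSet.univ, ?_, fun g _ u => ?_⟩
        · rw [MeasureTheory.measure_univ]
          exact ENNReal.div_le_of_le_mul (by norm_num)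
        · have h0 : ∀ w, rankOneResidual A w = 0 := fun w => by
            rw [rankOneResidual, hA, Matrix.zero_mul]
          rw [h0, h0]
          have := Real.rpow_nonneg (schattenNorm_nonneg p (0 : Matrix (Fin n) (Fin d) ℝ)) p
          nlinarith
      · exact exists_measurableSet_krylovIteration hp hε0 hε1 S hA
    refine ⟨G, hGm, hG, fun g hg u _ => ⟨?_, hres g hg u⟩⟩
    exact le_one_add_mul_of_rpow_le hp hε0.le (schattenNorm_nonneg _ _) (schattenNorm_nonneg _ _)
      (hres g hg u)
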